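/- Let $p\ge 1$, $n=2p+1$. Consider $n$ particles of unit mass on the unit sphere $\mathbb S^2\subset\mathbb R^3$, with spherical coordinates $(x,y,z)=(\sin\theta\cos\varphi,\sin\theta\sin\varphi,\cos\theta)$, $0<\theta_i<\pi$, no two particles coincident or antipodal, moving under the Hamiltonian $$H=\sum_{i=1}^n\Big(\frac{p_{\varphi_i}^2}{2\sin^2\theta_i}+\frac{p_{\theta_i}^2}{2}\Big)-U,\qquad U=\sum_{i<j}\cot d_{ij},$$ where $d_{ij}\in(0,\pi)$ is the spherical distance between the particles $i$ and $j$. The group $SO(2)$ acts by $\varphi_i\mapsto\varphi_i+s$, with first integral $J_2=\sum_i p_{\varphi_i}$. Let $\mathcal A$ be the Jacobi matrix, i.e. $(u_2,\dots,u_n,g)=\mathcal A(\varphi_1,\dots,\varphi_n)$ with $u_k=\varphi_k-\frac1{k-1}\sum_{i<k}\varphi_i$ and $g=\frac1n\sum_i\varphi_i$, and define $(v_2,\dots,v_n,G)$ by $(p_{\varphi_1},\dots,p_{\varphi_n})=\mathcal A^T(v_2,\dots,v_n,G)$, so that $G=J_2$. For $\alpha\in\mathbb R$, the reduced space $J_2^{-1}(n\alpha)/SO(2)$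 has the canonical coordinates $(u_2,\dots,u_n,\theta_1,\dots,\theta_n,v_2,\dots,v_n,p_{\theta_1},\dots,p_{\theta_n})$, and on it consider the Hamiltonian system of the reduced Hamiltonian $$H_2=\tfrac12 \vec v^{\,T}\mathcal A S^2\mathcal A^T\vec v+\tfrac12\sum_{i=1}^n p_{\theta_i}^2-U(u_2,\dots,u_n,\theta_1,\dots,\theta_n),$$ with $\vec v=(v_2,\dots,v_n,n\alpha)$ and $S=\mathrm{diag}(1/\sin\theta_1,\dots,1/\sin\theta_n)$. The relative equilibrium in which the regular $n$-gon $\varphi_i=2\pi i/n$, $\theta_i=\pi/2$ rotates with angular velocity $\alpha$ corresponds to the point $$Y_\alpha=\Big(\frac{2\pi}n,\frac{3\pi}n,\dots,\frac{n\pi}n,\frac\pi2,\dots,\frac\pi2,0,\dots,0,0,\dots,0\Big).$$ Put $$\Theta_1=2\sum_{j=1}^p\frac{1-\cos(2\pi j/n)}{\sin^3(2\pi j/n)}.$$ Then $Y_\alpha$ is an equilibrium of the reduced system for every $\alpha\in\mathbb R$. If $\alpha^2<\Theta_1$, it is linearly unstable: the linearization of the reduced system at $Y_\alpha$ has an eigenvalue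 with positive real part. If $\alpha^2>\Theta_1$, it is Lyapunov stable: for every $\varepsilon>0$ there is $\delta>0$ such that every motion of the reduced system that starts $\delta$-close to $Y_\alpha$ exists for all times $t\ge0$ and stays $\varepsilon$-close to $Y_\alpha$. -/

import Mathlib

open scoped BigOperators

noncomputable section

namespace CurvedNBody

/-! ### Autonomous systems, Hamiltonian vector fields and stability -/

section Dynamics

variable {E : Type*} [NormedAddCommGroup E] [NormedSpace ℝ E]

/-- `γ`, restricted to the set `s` of times, is a solution of `ż = X z` staying in the
phase space `D`. -/
def IsSolutionOn (D : Set E) (X : E → E) (γ : ℝ → E) (s : Set ℝ) : Prop :=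
  Set.MapsTo γ s D ∧ IsIntegralCurveOn γ (fun _ => X) s

/-- `z₀` is an equilibrium of `ż = X z` in the phase space `D`. -/
def IsEquilibrium (D : Set E) (X : E → E) (z₀ : E) : Prop :=
  z₀ ∈ D ∧ X z₀ = 0

/-- Lyapunov stability of the equilibrium `z₀` of `ż = X z` on `D`: for every `ε > 0` there is
`δ > 0` such that the motion from every initial point `δ`-close to `z₀` exists for all times
`t ≥ 0`, and every solution from such a point stays `ε`-close to `z₀` as long as it is defined. -/
def IsLyapunovStable (D : Set E) (X : E → E) (z₀ : E) : Prop :=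
  IsEquilibrium D X z₀ ∧
    ∀ ε > 0, ∃ δ > 0, ∀ x ∈ D, dist x z₀ < δ →
      (∃ γ : ℝ → E, γ 0 = x ∧ IsSolutionOn D X γ (Set.Ici 0)) ∧
      ∀ (γ : ℝ → E) (T : ℝ), γ 0 = x → IsSolutionOn D X γ (Set.Ico 0 T) →
        ∀ t ∈ Set.Ico 0 T, dist (γ t) z₀ < ε

/-- Linear instability of the equilibrium `z₀`: the linearization of `X` at `z₀` has a (complex)
eigenvalue with positive real part, so that the linearized system has exponentially growing
solutions. -/
def IsLinearlyUnstable (D : Set E) (X : E → E) (z₀ : E) : Prop :=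
  IsEquilibrium D X z₀ ∧
    ∃ L : E →L[ℝ] E, HasFDerivAt X L z₀ ∧
      ∃ μ : ℂ, 0 < μ.re ∧
        Module.End.HasEigenvalue ((L : E →ₗ[ℝ] E).baseChange ℂ) μ

/-- The origin is not a stable equilibrium of a linear system `ẏ = L y` that has an eigenvalue
with positive real part. -/
theorem not_isLyapunovStable_of_hasEigenvalue (L : E →L[ℝ] E) (μ : ℂ) (hμ : 0 < μ.re)
    (h : Module.End.HasEigenvalue ((L : E →ₗ[ℝ] E).baseChange ℂ) μ) :
    ¬ IsLyapunovStable Set.univ (fun y => L y) 0 := by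
  intro hst
  obtain ⟨w, hw⟩ := h.exists_hasEigenvector
  let R : TensorProduct ℝ ℂ E →ₗ[ℝ] E :=
    (TensorProduct.lid ℝ E).toLinearMap ∘ₗ LinearMap.rTensor E Complex.reLm
  let J : TensorProduct ℝ ℂ E →ₗ[ℝ] E :=
    (TensorProduct.lid ℝ E).toLinearMap ∘ₗ LinearMap.rTensor E Complex.imLm
  have hR : ∀ (z : ℂ) (e : E), R (z ⊗ₜ[ℝ] e) = z.re • e := fun z e => by simp [R]
  have hJ : ∀ (z : ℂ) (e : E), J (z ⊗ₜ[ℝ] e) = z.im • e := fun z e => by simp [J]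
  have hdec : ∀ w : TensorProduct ℝ ℂ E,
      w = (1 : ℂ) ⊗ₜ[ℝ] R w + Complex.I ⊗ₜ[ℝ] J w := by
    intro w
    induction w with
    | zero => simp
    | tmul z e =>
      rw [hR, hJ, ← TensorProduct.smul_tmul, ← TensorProduct.smul_tmul, ← TensorProduct.add_tmul]
      congr 1
      apply Complex.ext <;> simp
    | add a b ha hb =>
      rw [map_add, map_add, TensorProduct.tmul_add, TensorProduct.tmul_add]
      conv_lhs => rw [ha, hb]
      abel
  have hRL : ∀ w, R ((L : E →ₗ[ℝ] E).baseChange ℂ w) = L (R w) := by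
    intro w
    induction w with
    | zero => simp
    | tmul z e => simp [hR]
    | add a b ha hb => simp only [map_add, ha, hb]
  have hJL : ∀ w, J ((L : E →ₗ[ℝ] E).baseChange ℂ w) = L (J w) := by
    intro w
    induction w with
    | zero => simp
    | tmul z e => simp [hJ]
    | add a b ha hb => simp only [map_add, ha, hb]
  have hRm : ∀ w, R (μ • w) = μ.re • R w - μ.im • J w := by
    intro w
    induction w with
    | zero => simp
    | tmul z e => rw [TensorProduct.smul_tmul', hR, hR, hJ, smul_smul, smul_smul, ← sub_smul]; simp
    | add a b ha hb => simp only [map_add, smul_add, ha, hb]; abel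
  have hJm : ∀ w, J (μ • w) = μ.re • J w + μ.im • R w := by
    intro w
    induction w with
    | zero => simp
    | tmul z e => rw [TensorProduct.smul_tmul', hJ, hR, hJ, smul_smul, smul_smul, ← add_smul]; simp
    | add a b ha hb => simp only [map_add, smul_add, ha, hb]; abel
  obtain ⟨x, hx⟩ : ∃ x, x = R w := ⟨_, rfl⟩
  obtain ⟨y, hy⟩ : ∃ y, y = J w := ⟨_, rfl⟩
  have hLx : L x = μ.re • x - μ.im • y := by rw [hx, hy, ← hRm, ← hw.apply_eq_smul, hRL]
  have hLy : L y = μ.re • y + μ.im • x := by rw [hx, hy, ← hJm, ← hw.apply_eq_smul, hJL]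
  have hne : ¬ (x = 0 ∧ y = 0) := by
    rintro ⟨h1, h2⟩
    apply hw.2
    rw [hdec w, ← hx, ← hy, h1, h2]; simp
  obtain ⟨-, hst⟩ := hst
  obtain ⟨δ, hδ, hst⟩ := hst 1 one_pos
  set a := μ.re
  set b := μ.im
  -- a solution `s e^{at} (cos bt x - sin bt y)` and its companion
  have key : ∀ x y : E, L x = a • x - b • y → L y = a • y + b • x → ∀ s : ℝ, ‖s • x‖ < δ →
      ∀ t ≥ 0, ‖(s * Real.exp (a * t)) • (Real.cos (b * t) • x - Real.sin (b * t) • y)‖ < 1 := by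
    intro x y hLx hLy s hs t ht
    have := (hst (s • x) (Set.mem_univ _) (by simpa using hs)).2
      (fun t => (s * Real.exp (a * t)) • (Real.cos (b * t) • x - Real.sin (b * t) • y)) (t + 1)
      (by simp) ⟨fun _ _ => Set.mem_univ _, fun r _ => HasDerivAt.hasDerivWithinAt ?_⟩ t
      ⟨ht, by linarith⟩
    · simpa using this
    · have h1 : HasDerivAt (fun t : ℝ => s * Real.exp (a * t)) (s * (Real.exp (a * r) * (a * 1))) r :=
        (((hasDerivAt_id r).const_mul a).exp).const_mul s
      have h2 : HasDerivAt (fun t : ℝ => Real.cos (b * t)) (-Real.sin (b * r) * (b * 1)) r :=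
        ((hasDerivAt_id r).const_mul b).cos
      have h3 : HasDerivAt (fun t : ℝ => Real.sin (b * t)) (Real.cos (b * r) * (b * 1)) r :=
        ((hasDerivAt_id r).const_mul b).sin
      convert h1.smul ((h2.smul_const x).sub (h3.smul_const y)) using 1
      · rfl
      · change L _ = _
        rw [map_smul, map_sub, map_smul, map_smul, hLx, hLy]
        simp only [Pi.sub_apply]
        module
  obtain ⟨s, hs, hs1, hs2⟩ : ∃ s : ℝ, 0 < s ∧ ‖s • x‖ < δ ∧ ‖s • y‖ < δ := by
    have hp : 0 < ‖x‖ + ‖y‖ + 1 := by positivity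
    refine ⟨δ / (‖x‖ + ‖y‖ + 1), by positivity, ?_, ?_⟩ <;>
    · rw [norm_smul, Real.norm_of_nonneg (by positivity), div_mul_eq_mul_div, div_lt_iff₀ hp]
      apply mul_lt_mul_of_pos_left _ hδ
      linarith [norm_nonneg x, norm_nonneg y]
  have hLx' : L (-x) = a • (-x) + b • y := by rw [map_neg, hLx]; module
  have bound : ∀ x y : E, L x = a • x - b • y → L y = a • y + b • x → ‖s • x‖ < δ → ‖s • y‖ < δ →
      x = 0 := by
    intro x y hLx hLy hs1 hs2
    have hle : ∀ t ≥ 0, s * Real.exp (a * t) * ‖x‖ ≤ 2 := by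
      intro t ht
      have h1 := key x y hLx hLy s hs1 t ht
      have h2 := key y (-x) (by rw [hLy]; module) (by rw [map_neg, hLx]; module) s hs2 t ht
      set k := s * Real.exp (a * t)
      set c := Real.cos (b * t) with hc
      set d := Real.sin (b * t) with hd
      have hk : 0 < k := by positivity
      have hcd : c * c + d * d = 1 := by
        have := Real.sin_sq_add_cos_sq (b * t); rw [← hc, ← hd] at this; nlinarith
      have e : k • x = c • (k • (c • x - d • y)) + d • (k • (c • y - d • (-x))) := by
        have : k • x = (k * (c * c + d * d)) • x := by rw [hcd, mul_one]
        rw [this]; module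
      calc k * ‖x‖ = ‖k • x‖ := by rw [norm_smul, Real.norm_of_nonneg hk.le]
        _ ≤ ‖c‖ * ‖k • (c • x - d • y)‖ + ‖d‖ * ‖k • (c • y - d • (-x))‖ := by
          rw [e, ← norm_smul, ← norm_smul]; exact norm_add_le _ _
        _ ≤ 1 * 1 + 1 * 1 := by
          gcongr
          · exact Real.abs_cos_le_one _
          · exact Real.abs_sin_le_one _
        _ = 2 := by norm_num
    by_contra hx0
    have hxp : 0 < ‖x‖ := norm_pos_iff.mpr hx0
    have ht := hle (2 / (s * ‖x‖ * a)) (by positivity)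
    have h3 : a * (2 / (s * ‖x‖ * a)) + 1 ≤ Real.exp (a * (2 / (s * ‖x‖ * a))) :=
      Real.add_one_le_exp _
    have h4 : a * (2 / (s * ‖x‖ * a)) = 2 / (s * ‖x‖) := by
      have : a ≠ 0 := hμ.ne'
      field_simp
    rw [h4] at h3 ht
    have h5 : s * ‖x‖ * (2 / (s * ‖x‖) + 1) ≤ 2 := by
      refine le_trans ?_ ht
      calc s * ‖x‖ * (2 / (s * ‖x‖) + 1) ≤ s * ‖x‖ * Real.exp (2 / (s * ‖x‖)) := by gcongr
        _ = _ := by ring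
    have h6 : s * ‖x‖ * (2 / (s * ‖x‖) + 1) = 2 + s * ‖x‖ := by field_simp
    have : 0 < s * ‖x‖ := by positivity
    linarith
  exact hne ⟨bound x y hLx hLy hs1 hs2,
    bound y (-x) (by rw [hLy]; module) (by rw [map_neg, hLx]; module) hs2
      (by rwa [smul_neg, norm_neg])⟩

/-- The Hamiltonian vector field of `H` in canonical coordinates `(q, p)`:
`q̇ᵢ = ∂H/∂pᵢ`, `ṗᵢ = -∂H/∂qᵢ`. -/
def hamiltonianVectorField {ι : Type*} [Fintype ι] [DecidableEq ι]
    (H : (ι → ℝ) × (ι → ℝ) → ℝ) (z : (ι → ℝ) × (ι → ℝ)) : (ι → ℝ) × (ι → ℝ) :=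
  (fun i => fderiv ℝ H z (0, Pi.single i 1), fun i => - fderiv ℝ H z (Pi.single i 1, 0))

end Dynamics

/-! ### The curved `(N + 1)`-body problem on the unit sphere, with unit masses -/

/-- The point `(sin θ cos φ, sin θ sin φ, cos θ)` of the unit sphere. -/
def spherePoint (φ θ : ℝ) : EuclideanSpace ℝ (Fin 3) :=
  !₂[Real.sin θ * Real.cos φ, Real.sin θ * Real.sin φ, Real.cos θ]

/-- The spherical distance `d ∈ [0, π]`, `cos d = x · y`, of two points of the unit sphere. -/
def sphereDist (x y : EuclideanSpace ℝ (Fin 3)) : ℝ :=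
  Real.arccos (inner ℝ x y)

/-- Configuration coordinates `(φ, θ)` of `N + 1` particles: `Sum.inl i` indexes `φᵢ` and
`Sum.inr i` indexes `θᵢ`. -/
abbrev Config (N : ℕ) : Type := Fin (N + 1) ⊕ Fin (N + 1) → ℝ

/-- Canonical coordinates `((φ, θ), (p_φ, p_θ))` of the full system. -/
abbrev Phase (N : ℕ) : Type := Config N × Config N

/-- The position of the `i`-th particle. -/
def position {N : ℕ} (q : Config N) (i : Fin (N + 1)) : EuclideanSpace ℝ (Fin 3) :=
  spherePoint (q (Sum.inl i)) (q (Sum.inr i))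

/-- The coordinates are regular (`0 < θᵢ < π`) and the configuration is off the singularity set
`Δ`: no two particles coincide or are antipodal. -/
def IsRegular {N : ℕ} (q : Config N) : Prop :=
  (∀ i, 0 < q (Sum.inr i) ∧ q (Sum.inr i) < Real.pi) ∧
    ∀ i j, i ≠ j → position q i ≠ position q j ∧ position q i ≠ - position q j

/-- `U = ∑_{i < j} cot dᵢⱼ`. -/
def potential {N : ℕ} (q : Config N) : ℝ :=
  ∑ i, ∑ j ∈ Finset.Ioi i, Real.cot (sphereDist (position q i) (position q j))

/-- `H = ∑ᵢ (p_{φᵢ}² / (2 sin² θᵢ) + p_{θᵢ}² / 2) - U`. -/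
def hamiltonian {N : ℕ} (x : Phase N) : ℝ :=
  ∑ i, (x.2 (Sum.inl i) ^ 2 / (2 * Real.sin (x.1 (Sum.inr i)) ^ 2) + x.2 (Sum.inr i) ^ 2 / 2)
    - potential x.1

/-- The `SO(2)`-action (in the angular coordinates) `φᵢ ↦ φᵢ + s`. -/
def rotate {N : ℕ} (s : ℝ) (x : Phase N) : Phase N :=
  (Sum.elim (fun i => x.1 (Sum.inl i) + s) (fun i => x.1 (Sum.inr i)), x.2)

/-- The first integral `J₂ = ∑ᵢ p_{φᵢ}` of the `SO(2)`-action. -/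
def momentum {N : ℕ} (x : Phase N) : ℝ :=
  ∑ i, x.2 (Sum.inl i)

/-! ### Partial reduction through Jacobi coordinates -/

/-- The Jacobi matrix: row `k < N` (counting from `0`) of `A φ` is
`φ_{k+1} - (φ_0 + ⋯ + φ_k) / (k + 1)`, the last row is the mean of the `φᵢ`. -/
def jacobiMatrix (N : ℕ) : Matrix (Fin (N + 1)) (Fin (N + 1)) ℝ :=
  Matrix.of fun k j =>
    if k = Fin.last N then 1 / ((N : ℝ) + 1)
    else if j ≤ k then -(1 / ((k : ℕ) + 1 : ℝ))
    else if (j : ℕ) = (k : ℕ) + 1 then 1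
    else 0

/-- Coordinates `(u₂, …, uₙ, θ₁, …, θₙ)`, `n = N + 1`, of the reduced configuration space:
`Sum.inl k` indexes `u_{k+2}` and `Sum.inr i` indexes `θ_{i+1}`. -/
abbrev ReducedConfig (N : ℕ) : Type := Fin N ⊕ Fin (N + 1) → ℝ

/-- Canonical coordinates `((u, θ), (v, p_θ))` of the reduced space `J₂⁻¹(c) / SO(2)`. -/
abbrev ReducedPhase (N : ℕ) : Type := ReducedConfig N × ReducedConfig N

/-- The vector `(u₂, …, uₙ, g)`. -/
def append {N : ℕ} (u : Fin N → ℝ) (g : ℝ) : Fin (N + 1) → ℝ :=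
  Fin.snoc (α := fun _ => ℝ) u g

/-- The canonical transformation `φ = A⁻¹ (u, g)`, `p_φ = Aᵀ (v, G)`, with the
total momentum `G = c`. -/
def lift {N : ℕ} (c g : ℝ) (z : ReducedPhase N) : Phase N :=
  (Sum.elim ((jacobiMatrix N)⁻¹.mulVec (append (fun k => z.1 (Sum.inl k)) g))
      (fun i => z.1 (Sum.inr i)),
    Sum.elim ((jacobiMatrix N).transpose.mulVec (append (fun k => z.2 (Sum.inl k)) c))
      (fun i => z.2 (Sum.inr i)))

/-- The reduced Hamiltonian `H₂` on `J₂⁻¹(c) / SO(2)`: the value of `H` at any lift to `J₂⁻¹(c)`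
(it does not depend on the coordinate `g`, which is taken to be `0`). -/
def reducedHamiltonian (N : ℕ) (c : ℝ) (z : ReducedPhase N) : ℝ :=
  hamiltonian (lift c 0 z)

/-- The (open) domain of the reduced system in the coordinates `((u, θ), (v, p_θ))`. -/
def reducedPhaseSpace (N : ℕ) : Set (ReducedPhase N) :=
  {z | IsRegular (lift 0 0 z).1}

/-- The reduced equilibrium `Y = (2π/n, 3π/n, …, nπ/n, π/2, …, π/2, 0, …, 0)`, `n = N + 1`. -/
def polygonEquilibrium (N : ℕ) : ReducedPhase N :=
  (Sum.elim (fun k => ((k : ℕ) + 2 : ℝ) * Real.pi / ((N : ℝ) + 1)) (fun _ => Real.pi / 2), 0)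

/-- The state at time `0` of the relative equilibrium that rotates the regular polygon on the
equator with angular velocity `α`: `φᵢ = 2 π i / n` (`i = 1, …, n`), `θᵢ = π / 2`,
`p_{φᵢ} = α`, `p_{θᵢ} = 0`. -/
def polygonState (N : ℕ) (α : ℝ) : Phase N :=
  (Sum.elim (fun i => 2 * Real.pi * ((i : ℕ) + 1 : ℝ) / ((N : ℝ) + 1)) (fun _ => Real.pi / 2),
    Sum.elim (fun _ => α) (fun _ => 0))

/-! ### The Jacobi coordinates parametrize the reduced space -/

theorem jacobiMatrix_last {N : ℕ} (φ : Fin (N + 1) → ℝ) :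
    (jacobiMatrix N).mulVec φ (Fin.last N) = (∑ j, φ j) / ((N : ℝ) + 1) := by
  simp [jacobiMatrix, Matrix.mulVec, dotProduct, div_eq_inv_mul, Finset.mul_sum]

theorem jacobiMatrix_castSucc {N : ℕ} (φ : Fin (N + 1) → ℝ) (k : Fin N) :
    (jacobiMatrix N).mulVec φ k.castSucc =
      φ k.succ - (∑ j ∈ Finset.Iic k.castSucc, φ j) / ((k : ℕ) + 1 : ℝ) := by
  have h : ∀ j : Fin (N + 1), jacobiMatrix N k.castSucc j * φ j =
      (if j = k.succ then φ j else 0) +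
        (if j ∈ Finset.Iic k.castSucc then -(φ j / ((k : ℕ) + 1 : ℝ)) else 0) := by
    intro j
    have hk : k.castSucc ≠ Fin.last N := Fin.castSucc_ne_last k
    by_cases h1 : j ≤ k.castSucc
    · have h2 : j ≠ k.succ := by
        rintro rfl
        exact absurd h1 (by simp [Fin.le_def])
      simp [jacobiMatrix, hk, h1, h2]; ring
    · by_cases h2 : j = k.succ
      · subst h2
        simp [jacobiMatrix, hk, h1]
      · have h3 : (j : ℕ) ≠ (k : ℕ) + 1 := fun h => h2 (Fin.ext (by simpa using h))
        simp [jacobiMatrix, hk, h1, h2, h3]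
  rw [Matrix.mulVec, dotProduct, Finset.sum_congr rfl (fun j _ => h j), Finset.sum_add_distrib,
    Finset.sum_ite_eq', Finset.sum_ite_mem, Finset.univ_inter, Finset.sum_neg_distrib,
    Finset.sum_div]
  simp [sub_eq_add_neg]

theorem isUnit_det_jacobiMatrix (N : ℕ) : IsUnit (jacobiMatrix N).det := by
  rw [isUnit_iff_ne_zero]
  intro h0
  obtain ⟨φ, hne, hφ⟩ := Matrix.exists_mulVec_eq_zero_iff.mpr h0
  have hall : ∀ m : ℕ, ∀ hm : m < N + 1, φ ⟨m, hm⟩ = φ 0 := by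
    intro m
    induction m using Nat.strong_induction_on with
    | _ m ih =>
      intro hm
      rcases m with _ | m
      · rfl
      · have hk := congrFun hφ (Fin.castSucc ⟨m, by omega⟩)
        rw [jacobiMatrix_castSucc] at hk
        have hs : ∑ j ∈ Finset.Iic (Fin.castSucc (⟨m, by omega⟩ : Fin N)), φ j
            = ((m : ℝ) + 1) * φ 0 := by
          rw [Finset.sum_congr rfl (g := fun _ => φ 0)]
          · simp
          · intro j hj
            have : (j : ℕ) ≤ m := by simpa [Fin.le_def] using hj
            exact ih j (by omega) j.2
        rw [hs] at hk
        have hm0 : (m : ℝ) + 1 ≠ 0 := by positivity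
        simp only [Pi.zero_apply] at hk
        rw [mul_div_cancel_left₀ _ hm0] at hk
        exact sub_eq_zero.mp hk
  have hlast := congrFun hφ (Fin.last N)
  have hc : ∀ j, φ j = φ 0 := fun j => hall j j.2
  rw [jacobiMatrix_last, Finset.sum_congr rfl (fun j _ => hc j)] at hlast
  have hN : (N : ℝ) + 1 ≠ 0 := by positivity
  have h00 : φ 0 = 0 := by
    simpa [hN] using hlast
  exact hne (funext fun j => (hc j).trans h00)

/-- Lifts of points of the reduced space lie in the momentum level set. -/
theorem momentum_lift {N : ℕ} (c g : ℝ) (z : ReducedPhase N) : momentum (lift c g z) = c := by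
  have hN : (N : ℝ) + 1 ≠ 0 := by positivity
  have h := jacobiMatrix_castSucc (N := N) (fun _ => 1)
  have hl := jacobiMatrix_last (N := N) (fun _ => 1)
  have h1 : (jacobiMatrix N).mulVec (fun _ => 1) = append (fun _ => 0) 1 := by
    funext i
    refine Fin.lastCases ?_ (fun k => ?_) i
    · rw [hl]; simp [append, hN]
    · rw [h]
      have : ((k : ℕ) : ℝ) + 1 ≠ 0 := by positivity
      simp [append, this]
  have h2 : momentum (lift c g z) = dotProduct (fun _ => 1)
      ((jacobiMatrix N).transpose.mulVec (append (fun k => z.2 (Sum.inl k)) c)) := by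
    simp [momentum, lift, dotProduct]
  rw [h2, Matrix.dotProduct_mulVec, Matrix.vecMul_transpose, h1]
  simp [dotProduct, Fin.sum_univ_castSucc, append]

/-- The rotation by `s` translates the coordinate `g` of a lift and fixes the other ones. -/
theorem rotate_lift {N : ℕ} (s c g : ℝ) (z : ReducedPhase N) :
    rotate s (lift c g z) = lift c (g + s) z := by
  have hN : (N : ℝ) + 1 ≠ 0 := by positivity
  have h1 : (jacobiMatrix N).mulVec (fun _ => s) = append (fun _ => 0) s := by
    funext i
    refine Fin.lastCases ?_ (fun k => ?_) i
    · rw [jacobiMatrix_last]; simp [append, hN]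
    · rw [jacobiMatrix_castSucc]
      have : ((k : ℕ) : ℝ) + 1 ≠ 0 := by positivity
      simp [append, this]
  have h2 : (jacobiMatrix N)⁻¹.mulVec (append (fun _ => 0) s) = fun _ => s := by
    rw [← h1, Matrix.mulVec_mulVec, Matrix.nonsing_inv_mul _ (isUnit_det_jacobiMatrix N),
      Matrix.one_mulVec]
  have h3 : append (fun k => z.1 (Sum.inl k)) (g + s) =
      append (fun k => z.1 (Sum.inl k)) g + append (fun _ => 0) s := by
    funext i
    refine Fin.lastCases ?_ (fun k => ?_) i <;> simp [append]
  simp only [rotate, lift, h3, Matrix.mulVec_add, h2, Prod.mk.injEq, and_true]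
  funext i
  rcases i with i | i <;> simp

/-- The Hamiltonian is invariant under the `SO(2)`-action. -/
theorem hamiltonian_rotate {N : ℕ} (s : ℝ) (x : Phase N) :
    hamiltonian (rotate s x) = hamiltonian x := by
  have hp : potential (rotate s x).1 = potential x.1 := by
    unfold potential
    refine Finset.sum_congr rfl fun i _ => Finset.sum_congr rfl fun j _ => ?_
    refine congrArg Real.cot (congrArg Real.arccos ?_)
    simp only [position, rotate, spherePoint, Sum.elim_inl, Sum.elim_inr]
    simp [PiLp.inner_apply, Fin.sum_univ_three, Real.cos_add, Real.sin_add]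
    have := Real.sin_sq_add_cos_sq s
    linear_combination (Real.sin (x.1 (Sum.inr i)) * Real.sin (x.1 (Sum.inr j)) *
      (Real.cos (x.1 (Sum.inl i)) * Real.cos (x.1 (Sum.inl j)) +
        Real.sin (x.1 (Sum.inl i)) * Real.sin (x.1 (Sum.inl j)))) * this
  simp only [hamiltonian, hp]
  simp [rotate]

/-- The coordinates `((u, θ), (v, p_θ))` parametrize `J₂⁻¹(c) / SO(2)`: every state of momentum
`c` is, for exactly one reduced point `z` and one rotation, the rotation of the lift of `z`. -/
theorem existsUnique_lift {N : ℕ} (c : ℝ) (x : Phase N) (hx : momentum x = c) :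
    ∃! zs : ReducedPhase N × ℝ, x = rotate zs.2 (lift c 0 zs.1) := by
  have hA := isUnit_det_jacobiMatrix N
  have hAt : IsUnit (jacobiMatrix N).transpose.det := by rwa [Matrix.det_transpose]
  have happ : ∀ w : Fin (N + 1) → ℝ, append (fun k => w k.castSucc) (w (Fin.last N)) = w := by
    intro w; funext i
    refine Fin.lastCases ?_ (fun k => ?_) i <;> simp [append]
  obtain ⟨w, hw⟩ : ∃ w, w = (jacobiMatrix N).mulVec (fun i => x.1 (Sum.inl i)) := ⟨_, rfl⟩
  obtain ⟨r, hr⟩ : ∃ r, r = (jacobiMatrix N).transpose⁻¹.mulVec (fun i => x.2 (Sum.inl i)) :=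
    ⟨_, rfl⟩
  have hw' : (jacobiMatrix N)⁻¹.mulVec w = fun i => x.1 (Sum.inl i) := by
    rw [hw, Matrix.mulVec_mulVec, Matrix.nonsing_inv_mul _ hA, Matrix.one_mulVec]
  have hr' : (jacobiMatrix N).transpose.mulVec r = fun i => x.2 (Sum.inl i) := by
    rw [hr, Matrix.mulVec_mulVec, Matrix.mul_nonsing_inv _ hAt, Matrix.one_mulVec]
  let z : ReducedPhase N := (Sum.elim (fun k => w k.castSucc) (fun i => x.1 (Sum.inr i)),
    Sum.elim (fun k => r k.castSucc) (fun i => x.2 (Sum.inr i)))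
  have hz : x = lift (r (Fin.last N)) (w (Fin.last N)) z := by
    refine Prod.ext ?_ ?_ <;> funext i <;> rcases i with i | i
    · simp [lift, z, happ, hw']
    · simp [lift, z]
    · simp [lift, z, happ, hr']
    · simp [lift, z]
  have hc : r (Fin.last N) = c := by rw [← hx, hz, momentum_lift]
  rw [hc] at hz
  refine ⟨(z, w (Fin.last N)), by simp only [rotate_lift, zero_add]; exact hz, ?_⟩
  rintro ⟨z', s⟩ h
  simp only [rotate_lift, zero_add] at h
  have h1 : w = append (fun k => z'.1 (Sum.inl k)) s := by
    have : (fun i => x.1 (Sum.inl i)) =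
        (jacobiMatrix N)⁻¹.mulVec (append (fun k => z'.1 (Sum.inl k)) s) := by
      rw [h]; simp [lift]
    rw [hw, this, Matrix.mulVec_mulVec, Matrix.mul_nonsing_inv _ hA, Matrix.one_mulVec]
  have h2 : r = append (fun k => z'.2 (Sum.inl k)) c := by
    have : (fun i => x.2 (Sum.inl i)) =
        (jacobiMatrix N).transpose.mulVec (append (fun k => z'.2 (Sum.inl k)) c) := by
      rw [h]; simp [lift]
    rw [hr, this, Matrix.mulVec_mulVec, Matrix.nonsing_inv_mul _ hAt, Matrix.one_mulVec]
  refine Prod.ext (Prod.ext ?_ ?_) ?_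
  · funext i
    rcases i with k | i
    · simp [z, h1, append]
    · simp only [z, Sum.elim_inr]; rw [h]; simp [lift]
  · funext i
    rcases i with k | i
    · simp [z, h2, append]
    · simp only [z, Sum.elim_inr]; rw [h]; simp [lift]
  · simp [h1, append]

/-- The coordinates `((u, θ), (v, p_θ))` are canonical: along `J₂⁻¹(c)` the canonical form
`∑ (dφᵢ ∧ dp_{φᵢ} + dθᵢ ∧ dp_{θᵢ})` pulls back to `∑ duₖ ∧ dvₖ + ∑ dθᵢ ∧ dp_{θᵢ}`
(the differential of `lift c g` is `lift 0 0`). -/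
theorem symplectic_lift {N : ℕ} (z z' : ReducedPhase N) :
    dotProduct (lift 0 0 z).1 (lift 0 0 z').2 - dotProduct (lift 0 0 z').1 (lift 0 0 z).2 =
      dotProduct z.1 z'.2 - dotProduct z'.1 z.2 := by
  have key : ∀ z z' : ReducedPhase N,
      dotProduct (lift 0 0 z).1 (lift 0 0 z').2 = dotProduct z.1 z'.2 := by
    intro z z'
    have h : dotProduct
        ((jacobiMatrix N)⁻¹.mulVec (append (fun k => z.1 (Sum.inl k)) 0))
        ((jacobiMatrix N).transpose.mulVec (append (fun k => z'.2 (Sum.inl k)) 0)) =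
        ∑ k, z.1 (Sum.inl k) * z'.2 (Sum.inl k) := by
      rw [Matrix.dotProduct_mulVec, Matrix.vecMul_transpose, Matrix.mulVec_mulVec,
        Matrix.mul_nonsing_inv _ (isUnit_det_jacobiMatrix N), Matrix.one_mulVec]
      simp [dotProduct, Fin.sum_univ_castSucc, append]
    simp only [dotProduct, Fintype.sum_sum_type] at h ⊢
    simp only [lift, Sum.elim_inl, Sum.elim_inr] at h ⊢
    rw [h]
  rw [key, key]

/-- The explicit reduced Hamiltonian `½ vᵀ P v + ½ ∑ p_{θᵢ}² - U(u, θ)`, with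
`P = A S S Aᵀ`, `S = diag (1 / sin θᵢ)`, and last component of `v` equal to `c`. -/
theorem reducedHamiltonian_eq {N : ℕ} (c : ℝ) (z : ReducedPhase N) :
    reducedHamiltonian N c z =
      1 / 2 * dotProduct (append (fun k => z.2 (Sum.inl k)) c)
        ((jacobiMatrix N * Matrix.diagonal (fun i => 1 / Real.sin (z.1 (Sum.inr i))) *
          Matrix.diagonal (fun i => 1 / Real.sin (z.1 (Sum.inr i))) *
          (jacobiMatrix N).transpose).mulVec (append (fun k => z.2 (Sum.inl k)) c)) +
      ∑ i, z.2 (Sum.inr i) ^ 2 / 2 - potential (lift 0 0 z).1 := by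
  rw [Matrix.mul_assoc, Matrix.mul_assoc, ← Matrix.mulVec_mulVec, Matrix.dotProduct_mulVec,
    ← Matrix.mulVec_transpose, ← Matrix.mulVec_mulVec, ← Matrix.mulVec_mulVec]
  simp only [reducedHamiltonian, hamiltonian, Finset.sum_add_distrib, dotProduct, Finset.mul_sum,
    Matrix.mulVec_diagonal]
  congr 2
  refine Finset.sum_congr rfl fun i _ => ?_
  simp only [lift, Sum.elim_inl, Sum.elim_inr]
  ring

/-- The regular polygon relative equilibrium of angular velocity `α` reduces to
`polygonEquilibrium`. -/
theorem lift_polygonEquilibrium (N : ℕ) (α : ℝ) :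
    lift (((N : ℝ) + 1) * α) (Real.pi * ((N : ℝ) + 2) / ((N : ℝ) + 1)) (polygonEquilibrium N) =
      polygonState N α := by
  have hN : (N : ℝ) + 1 ≠ 0 := by positivity
  have hsum : ∀ n : ℕ, ∑ i ∈ Finset.range n, ((i : ℝ) + 1) = n * (n + 1) / 2 := by
    intro n
    induction n with
    | zero => simp
    | succ n ih => rw [Finset.sum_range_succ, ih]; push_cast; ring
  have h1 : (jacobiMatrix N).mulVec
      (fun i => 2 * Real.pi * ((i : ℕ) + 1 : ℝ) / ((N : ℝ) + 1)) =
      append (fun k => ((k : ℕ) + 2 : ℝ) * Real.pi / ((N : ℝ) + 1))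
        (Real.pi * ((N : ℝ) + 2) / ((N : ℝ) + 1)) := by
    funext i
    refine Fin.lastCases ?_ (fun k => ?_) i
    · rw [jacobiMatrix_last, ← Finset.sum_div, ← Finset.mul_sum,
        Fin.sum_univ_eq_sum_range (fun i => (i : ℝ) + 1) (N + 1), hsum]
      simp only [append, Fin.snoc_last]
      push_cast
      field_simp
      ring
    · have hk : ((k : ℕ) : ℝ) + 1 ≠ 0 := by positivity
      have hIic : ∑ j ∈ Finset.Iic k.castSucc, (((j : ℕ) : ℝ) + 1) =
          ∑ j ∈ Finset.range ((k : ℕ) + 1), ((j : ℝ) + 1) := by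
        refine Finset.sum_bij (fun j _ => (j : ℕ)) ?_ ?_ ?_ ?_
        · intro j hj
          have : (j : ℕ) ≤ k := by simpa [Fin.le_def] using hj
          simp; omega
        · intro a _ b _ h; exact Fin.ext h
        · intro b hb
          have hb : b < (k : ℕ) + 1 := by simpa using hb
          exact ⟨⟨b, by omega⟩, by simp [Fin.le_def]; omega, rfl⟩
        · intro _ _; rfl
      rw [jacobiMatrix_castSucc, ← Finset.sum_div, ← Finset.mul_sum, hIic, hsum]
      simp only [append, Fin.snoc_castSucc, Fin.val_succ]
      push_cast
      field_simp
      ring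
  have h2 : (jacobiMatrix N).transpose.mulVec (append (fun _ => 0) (((N : ℝ) + 1) * α)) =
      fun _ => α := by
    funext i
    simp [Matrix.mulVec, dotProduct, Fin.sum_univ_castSucc, append, jacobiMatrix]
    field_simp
  refine Prod.ext ?_ ?_ <;> funext i <;> rcases i with i | i
  · simp only [lift, polygonEquilibrium, polygonState, Sum.elim_inl]
    rw [← h1, Matrix.mulVec_mulVec, Matrix.nonsing_inv_mul _ (isUnit_det_jacobiMatrix N),
      Matrix.one_mulVec]
  · simp [lift, polygonEquilibrium, polygonState]
  · simp [lift, polygonEquilibrium, polygonState, h2]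
  · simp [lift, polygonEquilibrium, polygonState]

end CurvedNBody

end

/-!
Write `H₂` for the reduced Hamiltonian. Near the polygon `H₂` is smooth, and along a line
`t ↦ Y + t w` it is the full Hamiltonian along the lifted line, so its first two derivatives at `Y`
are one-variable Taylor coefficients (`HasTwoJet`). Let `(a, b, ξ, ζ)` be the lift of `w`, the
components of the variation along `φ, θ, p_φ, p_θ`; then `∑ a = ∑ ξ = 0`. The first derivative is
`α ∑ ξ = 0`, since the forces cancel by symmetry. With `φᵢⱼ = φᵢ - φⱼ`, the second derivative is
(`secondVariation`)

`∑ ξ² + ∑ ζ² + (α² - Θ₁) ∑ b² + ∑_{i<j} (bᵢ - bⱼ)² / |sin φᵢⱼ|³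
  - 2 ∑_{i<j} cos φᵢⱼ / |sin φᵢⱼ|³ (aᵢ - aⱼ)²`.

*Stability.* If `α² > Θ₁`, all terms but the last are visibly nonnegative. The last one is a
circulant form, which the Fourier transform on `ℤ/n` diagonalizes (`sum_mul_sub_sq_eq`). For odd
`n` its eigenvalues on the non-constant modes are, up to a positive factor, the numbers
`f m = -∑_{s=1}^p cos yₛ / sin³ yₛ (1 - cos (2 m yₛ))`, `yₛ = 2πs/n`, `1 ≤ m ≤ p`. Taking second
differences in `m` cancels a factor `sin² yₛ` and taking a further difference leaves geometric sums
of a definite sign (`sum_sin_neg`); as the increment `f (p + 1) - f p` vanishes, this forces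
`f m > 0` (`pos_of_second_difference`). So the second derivative is positive definite, and stability
follows from conservation of energy (`isLyapunovStable_of_posDef`). The trapping of motions in a
small ball also gives their existence for all times, since local solutions exist for a time that is
uniform near `Y`.

*Instability.* In the direction in which all `θᵢ` move together the last two sums and their polar
forms vanish, so that the linearization leaves a plane invariant and acts on it as
`η̈ = (Θ₁ - α²) η`. If `α² < Θ₁` this gives the eigenvalue `√(Θ₁ - α²)`.
-/

noncomputable section

namespace CurvedNBody

/-! ### Lyapunov's theorem for a conserved quantity with a strict minimum -/

section Lyapunov

open Set Metric Filter Topology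

variable {E : Type*} [NormedAddCommGroup E] [NormedSpace ℝ E]

/-- `H` is constant along motions in a region where its derivative along `X` vanishes. -/
theorem comp_eq_of_isIntegralCurveOn_Icc {X : E → E} {H : E → ℝ} {B : Set E} {γ : ℝ → E} {T : ℝ}
    (hH : ∀ z ∈ B, DifferentiableAt ℝ H z) (hX : ∀ z ∈ B, fderiv ℝ H z (X z) = 0)
    (hγ : IsIntegralCurveOn γ (fun _ => X) (Icc 0 T)) (hB : ∀ t ∈ Icc 0 T, γ t ∈ B) :
    ∀ t ∈ Icc 0 T, H (γ t) = H (γ 0) := by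
  have hd : ∀ t ∈ Icc 0 T, HasDerivWithinAt (fun t => H (γ t)) 0 (Icc 0 T) t := by
    intro t ht
    have h := (hH _ (hB t ht)).hasFDerivAt.comp_hasDerivWithinAt t (hγ t ht)
    rwa [hX _ (hB t ht)] at h
  refine constant_of_has_deriv_right_zero (fun t ht => (hd t ht).continuousWithinAt) ?_
  intro t ht
  refine (hd t (Ico_subset_Icc_self ht)).mono_of_mem_nhdsWithin ?_
  exact mem_of_superset (Icc_mem_nhdsGE ht.2) (Icc_subset_Icc_left ht.1)

/-- A conserved quantity `H` that is at least `h` on the sphere of radius `ε` confines to the ball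
all motions that start in the ball with `H < h`. -/
theorem mem_ball_of_isIntegralCurveOn {X : E → E} {H : E → ℝ} {z₀ : E} {γ : ℝ → E} {T ε h : ℝ}
    (hH : ∀ z ∈ closedBall z₀ ε, DifferentiableAt ℝ H z)
    (hX : ∀ z ∈ closedBall z₀ ε, fderiv ℝ H z (X z) = 0)
    (hh : ∀ z ∈ sphere z₀ ε, h ≤ H z)
    (hγ : IsIntegralCurveOn γ (fun _ => X) (Icc 0 T)) (h0 : γ 0 ∈ ball z₀ ε) (h0' : H (γ 0) < h) :
    ∀ t ∈ Icc 0 T, γ t ∈ ball z₀ ε ∧ H (γ t) < h := by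
  have hcont : ContinuousOn (fun t => dist (γ t) z₀) (Icc 0 T) :=
    fun t ht => (hγ t ht).continuousWithinAt.dist continuousWithinAt_const
  have hball : ∀ t ∈ Icc 0 T, γ t ∈ ball z₀ ε := by
    by_contra! hcon
    obtain ⟨t₁, ht₁, hout⟩ := hcon
    rw [mem_ball, not_lt] at hout
    have hsub : Icc 0 t₁ ⊆ Icc 0 T := Icc_subset_Icc_right ht₁.2
    -- the first time at which the motion reaches the sphere
    have hcl : IsClosed (Icc 0 t₁ ∩ (fun t => dist (γ t) z₀) ⁻¹' Ici ε) :=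
      (hcont.mono hsub).preimage_isClosed_of_isClosed isClosed_Icc isClosed_Ici
    obtain ⟨s, ⟨hs, hsε⟩, hleast⟩ := (isCompact_Icc.of_isClosed_subset hcl
      inter_subset_left).exists_isLeast ⟨t₁, ⟨ht₁.1, le_rfl⟩, hout⟩
    have hsub' : Icc 0 s ⊆ Icc 0 T := (Icc_subset_Icc_right hs.2).trans hsub
    obtain ⟨s', hs', hs'ε⟩ := intermediate_value_Icc hs.1 (hcont.mono hsub')
      (show ε ∈ Icc _ _ from ⟨(mem_ball.mp h0).le, hsε⟩)
    have hss' : s ≤ s' := hleast ⟨⟨hs'.1, hs'.2.trans hs.2⟩, hs'ε.ge⟩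
    obtain rfl : s = s' := le_antisymm hss' hs'.2
    have hin : ∀ t ∈ Icc 0 s, γ t ∈ closedBall z₀ ε := by
      intro t ht
      rcases ht.2.eq_or_lt with rfl | hlt
      · exact hs'ε.le
      · by_contra hc
        rw [mem_closedBall, not_le] at hc
        exact absurd (hleast ⟨⟨ht.1, ht.2.trans hs.2⟩, hc.le⟩) (not_le.mpr hlt)
    have := comp_eq_of_isIntegralCurveOn_Icc hH hX (hγ.mono hsub') hin s ⟨hs.1, le_rfl⟩
    linarith [hh (γ s) hs'ε]
  intro t ht
  refine ⟨hball t ht, ?_⟩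
  rwa [comp_eq_of_isIntegralCurveOn_Icc hH hX hγ (fun t ht => ball_subset_closedBall (hball t ht))
    t ht]

/-- If every point of `W` is the start of a motion in `W` of one and the same duration `τ`, then
concatenation of such motions yields motions for all times `t ≥ 0`. -/
theorem exists_isIntegralCurveOn_Ici {X : E → E} {W : Set E} {τ : ℝ} (hτ : 0 < τ)
    (hW : ∀ x ∈ W, ∃ γ : ℝ → E, γ 0 = x ∧ IsIntegralCurveOn γ (fun _ => X) (Icc 0 τ) ∧
      ∀ t ∈ Icc 0 τ, γ t ∈ W) {x : E} (hx : x ∈ W) :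
    ∃ γ : ℝ → E, γ 0 = x ∧ IsIntegralCurveOn γ (fun _ => X) (Ici 0) ∧ ∀ t ∈ Ici 0, γ t ∈ W := by
  choose! Φ h0 hint hmem using hW
  let y : ℕ → E := fun k => Nat.rec x (fun _ z => Φ z τ) k
  have hy : ∀ k, y k ∈ W := by
    intro k
    induction k with
    | zero => exact hx
    | succ k ih => exact hmem _ ih τ ⟨hτ.le, le_rfl⟩
  let γ : ℝ → E := fun t => Φ (y ⌊t / τ⌋₊) (t - ⌊t / τ⌋₊ * τ)
  have hγ : ∀ k : ℕ, ∀ t ∈ Icc (k * τ) ((k + 1) * τ), γ t = Φ (y k) (t - k * τ) := by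
    intro k t ht
    have ht0 : 0 ≤ t / τ := div_nonneg (le_trans (by positivity) ht.1) hτ.le
    rcases ht.2.eq_or_lt with rfl | hlt
    · have hfl : ⌊((k : ℝ) + 1) * τ / τ⌋₊ = k + 1 := by
        rw [mul_div_cancel_right₀ _ hτ.ne']
        exact_mod_cast Nat.floor_natCast (k + 1)
      simp only [γ, hfl]
      have e1 : ((k : ℝ) + 1) * τ - ((k + 1 : ℕ) : ℝ) * τ = 0 := by push_cast; ring
      have e2 : ((k : ℝ) + 1) * τ - k * τ = τ := by ring
      rw [e1, e2]
      exact h0 _ (hy (k + 1))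
    · have hfl : ⌊t / τ⌋₊ = k := by
        rw [Nat.floor_eq_iff ht0, le_div_iff₀ hτ, div_lt_iff₀ hτ]
        exact ⟨ht.1, hlt⟩
      simp only [γ, hfl]
  have hpiece : ∀ k : ℕ, ∀ t ∈ Icc (k * τ) ((k + 1) * τ), γ t ∈ W ∧
      HasDerivWithinAt γ (X (γ t)) (Icc (k * τ) ((k + 1) * τ)) t := by
    intro k t ht
    have hmaps : MapsTo (fun t : ℝ => t - k * τ) (Icc (k * τ) ((k + 1) * τ)) (Icc 0 τ) := by
      intro s hs
      exact ⟨by linarith [hs.1], by linarith [hs.2]⟩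
    refine ⟨by rw [hγ k t ht]; exact hmem _ (hy k) _ (hmaps ht), ?_⟩
    have h1 := hint _ (hy k) _ (hmaps ht)
    have h2 : HasDerivWithinAt (fun t : ℝ => t - k * τ) 1 (Icc (k * τ) ((k + 1) * τ)) t :=
      (hasDerivWithinAt_id t _).sub_const _
    have h3 := h1.scomp t h2 hmaps
    rw [one_smul] at h3
    rw [hγ k t ht]
    exact h3.congr (fun s hs => hγ k s hs) (hγ k t ht)
  have hloc : ∀ t : ℝ, 0 ≤ t → ∃ k : ℕ, k * τ ≤ t ∧ t < (k + 1) * τ := by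
    intro t ht
    refine ⟨⌊t / τ⌋₊, ?_, ?_⟩
    · rw [← le_div_iff₀ hτ]; exact Nat.floor_le (div_nonneg ht hτ.le)
    · rw [← div_lt_iff₀ hτ]; exact Nat.lt_floor_add_one _
  refine ⟨γ, ?_, ?_, ?_⟩
  · have := hγ 0 0 (by simp [hτ.le])
    rw [this, Nat.cast_zero, zero_mul, sub_zero]
    exact h0 _ (hy 0)
  · intro t ht
    obtain ⟨k, hk1, hk2⟩ := hloc t ht
    have hright : HasDerivWithinAt γ (X (γ t)) (Ici t) t := by
      refine (hpiece k t ⟨hk1, hk2.le⟩).2.mono_of_mem_nhdsWithin ?_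
      exact mem_of_superset (Icc_mem_nhdsGE hk2) (Icc_subset_Icc_left hk1)
    rcases (mem_Ici.mp ht).eq_or_lt with rfl | hpos
    · exact hright
    · have hleft : HasDerivWithinAt γ (X (γ t)) (Iic t) t := by
        rcases hk1.eq_or_lt with heq | hlt
        · obtain ⟨j, rfl⟩ : ∃ j, k = j + 1 := Nat.exists_eq_succ_of_ne_zero (by
            rintro rfl; simp at heq; linarith)
          push_cast at heq
          refine (hpiece j t ⟨by linarith, heq.ge⟩).2.mono_of_mem_nhdsWithin ?_
          exact mem_of_superset (Icc_mem_nhdsLE (show (j : ℝ) * τ < t by linarith))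
            (Icc_subset_Icc_right heq.ge)
        · refine (hpiece k t ⟨hk1, hk2.le⟩).2.mono_of_mem_nhdsWithin ?_
          exact mem_of_superset (Icc_mem_nhdsLE hlt) (Icc_subset_Icc_right hk2.le)
      have h := hleft.union hright
      rw [Iic_union_Ici] at h
      exact h.mono (subset_univ _)
  · intro t ht
    obtain ⟨k, hk1, hk2⟩ := hloc t ht
    exact (hpiece k t ⟨hk1, hk2.le⟩).1

/-- **Lyapunov's theorem**: an equilibrium of a `C¹` vector field at which a conserved quantity
has a strict minimum, here with a quadratic lower bound, is stable. -/
theorem isLyapunovStable_of_quadratic_growth [CompleteSpace E] {D : Set E} {X : E → E} {z₀ : E}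
    {H : E → ℝ} {r κ : ℝ} (hr : 0 < r) (hκ : 0 < κ) (hX₁ : ContDiffAt ℝ 1 X z₀)
    (hX₀ : X z₀ = 0) (hD : closedBall z₀ r ⊆ D)
    (hH : ∀ z ∈ closedBall z₀ r, DifferentiableAt ℝ H z)
    (hX : ∀ z ∈ closedBall z₀ r, fderiv ℝ H z (X z) = 0)
    (hmin : ∀ z ∈ closedBall z₀ r, H z₀ + κ * dist z z₀ ^ 2 ≤ H z) :
    IsLyapunovStable D X z₀ := by
  refine ⟨⟨hD (mem_closedBall_self hr.le), hX₀⟩, fun ε₀ hε₀ => ?_⟩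
  obtain ⟨r₁, hr₁, τ, hτ, hflow⟩ :=
    hX₁.exists_forall_mem_closedBall_exists_eq_forall_mem_Ioo_hasDerivAt 0
  obtain ⟨ε, hε, hε₀', hεr, hεr₁⟩ : ∃ ε > 0, ε ≤ ε₀ ∧ ε ≤ r ∧ ε ≤ r₁ :=
    ⟨min ε₀ (min r r₁), by positivity, min_le_left _ _, (min_le_right _ _).trans (min_le_left _ _),
      (min_le_right _ _).trans (min_le_right _ _)⟩
  have hsub : closedBall z₀ ε ⊆ closedBall z₀ r := closedBall_subset_closedBall hεr
  have hsph : ∀ z ∈ sphere z₀ ε, H z₀ + κ * ε ^ 2 ≤ H z := by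
    intro z hz
    have h := hmin z (hsub (sphere_subset_closedBall hz))
    rwa [mem_sphere.mp hz] at h
  have hcont : ∀ᶠ z in 𝓝 z₀, z ∈ ball z₀ ε ∧ H z < H z₀ + κ * ε ^ 2 := by
    refine Filter.Eventually.and (ball_mem_nhds _ hε) ?_
    exact (hH z₀ (mem_closedBall_self hr.le)).continuousAt.eventually_lt_const
      (by linarith [mul_pos hκ (pow_pos hε 2)])
  obtain ⟨δ, hδ, hδ'⟩ := Metric.eventually_nhds_iff.mp hcont
  have trap := fun (γ : ℝ → E) (T : ℝ) (hγ : IsIntegralCurveOn γ (fun _ => X) (Icc 0 T)) =>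
    mem_ball_of_isIntegralCurveOn (fun z hz => hH z (hsub hz)) (fun z hz => hX z (hsub hz)) hsph hγ
  refine ⟨δ, hδ, fun x _ hxδ => ⟨?_, ?_⟩⟩
  · obtain ⟨γ, hγ0, hγ, hγW⟩ := exists_isIntegralCurveOn_Ici (X := X)
      (W := {z | z ∈ ball z₀ ε ∧ H z < H z₀ + κ * ε ^ 2}) (half_pos hτ) (fun y hy => by
        obtain ⟨γ, hγ0, hγ⟩ := hflow y (closedBall_subset_closedBall hεr₁
          (ball_subset_closedBall hy.1))
        have hγ' : IsIntegralCurveOn γ (fun _ => X) (Icc 0 (τ / 2)) := fun t ht =>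
          (hγ t ⟨by linarith [ht.1], by linarith [ht.2]⟩).hasDerivWithinAt
        exact ⟨γ, hγ0, hγ', trap γ _ hγ' (hγ0 ▸ hy.1) (hγ0 ▸ hy.2)⟩) (hδ' hxδ)
    exact ⟨γ, hγ0, fun t ht => hD (hsub (ball_subset_closedBall (hγW t ht).1)), hγ⟩
  · intro γ T hγ0 hγ t ht
    have := trap γ t (hγ.2.mono (Icc_subset_Ico_right ht.2)) (hγ0 ▸ (hδ' hxδ).1)
      (hγ0 ▸ (hδ' hxδ).2) t ⟨ht.1, le_rfl⟩
    exact lt_of_lt_of_le this.1 hε₀'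

end Lyapunov

/-! ### Second-order calculus at a critical point -/

section SecondOrder

open Set Metric Filter Topology

/-- The function `g` has the Taylor expansion `a + b t + c t² / 2 + ⋯` at `0`: it is
differentiable near `0`, and `a`, `b`, `c` are its value, first and second derivative there. -/
def HasTwoJet (g : ℝ → ℝ) (a b c : ℝ) : Prop :=
  g 0 = a ∧ ∃ g' : ℝ → ℝ, (∀ᶠ t in 𝓝 0, HasDerivAt g (g' t) t) ∧ g' 0 = b ∧ HasDerivAt g' c 0

namespace HasTwoJet

variable {f g : ℝ → ℝ} {a b c a' b' c' : ℝ}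

theorem hasDerivAt (h : HasTwoJet f a b c) : HasDerivAt f b 0 := by
  obtain ⟨-, f', h1, h2, -⟩ := h
  exact h2 ▸ h1.self_of_nhds

theorem add (hf : HasTwoJet f a b c) (hg : HasTwoJet g a' b' c') :
    HasTwoJet (fun t => f t + g t) (a + a') (b + b') (c + c') := by
  obtain ⟨rfl, f', h1, rfl, h3⟩ := hf
  obtain ⟨rfl, g', k1, rfl, k3⟩ := hg
  refine ⟨rfl, fun t => f' t + g' t, ?_, rfl, h3.add k3⟩
  filter_upwards [h1, k1] with t h k using h.add k

theorem sub (hf : HasTwoJet f a b c) (hg : HasTwoJet g a' b' c') :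
    HasTwoJet (fun t => f t - g t) (a - a') (b - b') (c - c') := by
  obtain ⟨rfl, f', h1, rfl, h3⟩ := hf
  obtain ⟨rfl, g', k1, rfl, k3⟩ := hg
  refine ⟨rfl, fun t => f' t - g' t, ?_, rfl, h3.sub k3⟩
  filter_upwards [h1, k1] with t h k using h.sub k

theorem mul (hf : HasTwoJet f a b c) (hg : HasTwoJet g a' b' c') :
    HasTwoJet (fun t => f t * g t) (a * a') (b * a' + a * b') (c * a' + 2 * b * b' + a * c') := by
  have hf0 := hf.hasDerivAt
  have hg0 := hg.hasDerivAt
  obtain ⟨rfl, f', h1, rfl, h3⟩ := hf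
  obtain ⟨rfl, g', k1, rfl, k3⟩ := hg
  refine ⟨rfl, fun t => f' t * g t + f t * g' t, ?_, rfl, ?_⟩
  · filter_upwards [h1, k1] with t h k using h.mul k
  · exact ((h3.mul hg0).add (hf0.mul k3)).congr_deriv (by ring)

theorem const (a : ℝ) : HasTwoJet (fun _ => a) a 0 0 :=
  ⟨rfl, fun _ => 0, Eventually.of_forall fun t => hasDerivAt_const t a, rfl, hasDerivAt_const _ _⟩

theorem sum {ι : Type*} {s : Finset ι} {f : ι → ℝ → ℝ} {a b c : ι → ℝ}
    (h : ∀ i ∈ s, HasTwoJet (f i) (a i) (b i) (c i)) :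
    HasTwoJet (fun t => ∑ i ∈ s, f i t) (∑ i ∈ s, a i) (∑ i ∈ s, b i) (∑ i ∈ s, c i) := by
  classical
  induction s using Finset.induction_on with
  | empty => simpa using const 0
  | insert i s hi ih =>
    simp only [Finset.sum_insert hi]
    exact (h i (Finset.mem_insert_self _ _)).add
      (ih fun j hj => h j (Finset.mem_insert_of_mem hj))

/-- The chain rule for two-jets. -/
theorem comp {F F' : ℝ → ℝ} {F'' : ℝ} (hf : HasTwoJet f a b c)
    (hF : ∀ᶠ x in 𝓝 a, HasDerivAt F (F' x) x) (hF' : HasDerivAt F' F'' a) :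
    HasTwoJet (fun t => F (f t)) (F a) (F' a * b) (F'' * b ^ 2 + F' a * c) := by
  have hf0 := hf.hasDerivAt
  obtain ⟨rfl, f', h1, rfl, h3⟩ := hf
  refine ⟨rfl, fun t => F' (f t) * f' t, ?_, rfl, ?_⟩
  · filter_upwards [h1, hf0.continuousAt.eventually hF] with t h k using k.comp t h
  · exact ((hF'.comp (0 : ℝ) hf0).mul h3).congr_deriv (by simp only [Function.comp]; ring)

theorem congr (h : HasTwoJet f a b c) (hfg : ∀ t, f t = g t) (ha : a = a') (hb : b = b')
    (hc : c = c') : HasTwoJet g a' b' c' := by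
  obtain rfl : f = g := funext hfg
  rwa [← ha, ← hb, ← hc]

theorem affine (a b : ℝ) : HasTwoJet (fun t => a + t * b) a b 0 := by
  refine ⟨by simp, fun _ => b, Eventually.of_forall fun t => ?_, rfl, hasDerivAt_const _ _⟩
  simpa using ((hasDerivAt_id t).mul_const b).const_add a

theorem sin (hf : HasTwoJet f a b c) : HasTwoJet (fun t => Real.sin (f t)) (Real.sin a)
    (Real.cos a * b) (-Real.sin a * b ^ 2 + Real.cos a * c) :=
  hf.comp (Eventually.of_forall Real.hasDerivAt_sin) (Real.hasDerivAt_cos a)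

theorem cos (hf : HasTwoJet f a b c) : HasTwoJet (fun t => Real.cos (f t)) (Real.cos a)
    (-Real.sin a * b) (-Real.cos a * b ^ 2 + -Real.sin a * c) :=
  hf.comp (Eventually.of_forall Real.hasDerivAt_cos) (Real.hasDerivAt_sin a).neg

theorem inv (hf : HasTwoJet f a b c) (ha : a ≠ 0) : HasTwoJet (fun t => (f t)⁻¹) a⁻¹
    (-(a ^ 2)⁻¹ * b) (2 * (a ^ 3)⁻¹ * b ^ 2 + -(a ^ 2)⁻¹ * c) := by
  refine hf.comp (F := fun x => x⁻¹) (F' := fun x => -(x ^ 2)⁻¹) ?_ ?_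
  · filter_upwards [isOpen_ne.mem_nhds ha] with x hx using hasDerivAt_inv hx
  · refine (((hasDerivAt_id a).pow 2).inv (by simpa using ha)).neg.congr_deriv ?_
    simp only [id, Pi.pow_apply]
    field_simp
    norm_num
    ring

/-- The derivatives of `H` in the direction `w` are read off from the restriction to the line. -/
theorem fderiv_eq {E : Type*} [NormedAddCommGroup E] [NormedSpace ℝ E] {H : E → ℝ} {z₀ w : E}
    (hH : ContDiffAt ℝ 2 H z₀) (h : HasTwoJet (fun t : ℝ => H (z₀ + t • w)) a b c) :
    fderiv ℝ H z₀ w = b ∧ fderiv ℝ (fderiv ℝ H) z₀ w w = c := by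
  have hline : ∀ t : ℝ, HasDerivAt (fun t : ℝ => z₀ + t • w) w t := by
    intro t
    simpa using ((hasDerivAt_id t).smul_const w).const_add z₀
  have hz : z₀ + (0 : ℝ) • w = z₀ := by simp
  have hev : ∀ᶠ t in 𝓝 (0 : ℝ), HasDerivAt (fun t : ℝ => H (z₀ + t • w))
      (fderiv ℝ H (z₀ + t • w) w) t := by
    have h1 : ∀ᶠ z in 𝓝 z₀, DifferentiableAt ℝ H z :=
      (hH.eventually (by simp)).mono fun z hz => hz.differentiableAt (by simp)
    have h2 : Tendsto (fun t : ℝ => z₀ + t • w) (𝓝 0) (𝓝 z₀) := by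
      simpa [ContinuousAt] using (hline 0).continuousAt
    filter_upwards [h2.eventually h1] with t ht
    exact ht.hasFDerivAt.comp_hasDerivAt t (hline t)
  obtain ⟨-, g', h1, rfl, h3⟩ := h
  have heq : (fun t : ℝ => fderiv ℝ H (z₀ + t • w) w) =ᶠ[𝓝 0] g' := by
    filter_upwards [hev, h1] with t h k using h.unique k
  constructor
  · simpa using heq.self_of_nhds
  · have h4 : HasFDerivAt (fderiv ℝ H) (fderiv ℝ (fderiv ℝ H) z₀) (z₀ + (0 : ℝ) • w) := by
      rw [hz]
      exact ((hH.fderiv_right (m := 1) (by norm_num)).differentiableAt (by simp)).hasFDerivAt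
    have h4' : HasDerivAt (fun t : ℝ => fderiv ℝ H (z₀ + t • w))
        (fderiv ℝ (fderiv ℝ H) z₀ w) 0 :=
      HasFDerivAt.comp_hasDerivAt (f := fun t : ℝ => z₀ + t • w) 0 h4 (hline 0)
    have h5 : HasDerivAt (fun t : ℝ => fderiv ℝ H (z₀ + t • w) w)
        (fderiv ℝ (fderiv ℝ H) z₀ w w) 0 := by
      have := h4'.clm_apply (hasDerivAt_const (0 : ℝ) w)
      simpa using this
    exact (h5.congr_of_eventuallyEq heq.symm).unique h3

end HasTwoJet

/-- A critical point with positive definite second derivative is a strict minimum, with a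
quadratic lower bound. -/
theorem exists_quadratic_growth {E : Type*} [NormedAddCommGroup E] [NormedSpace ℝ E]
    [FiniteDimensional ℝ E] {H : E → ℝ} {z₀ : E} (hH : ContDiffAt ℝ 2 H z₀)
    (h1 : fderiv ℝ H z₀ = 0) (h2 : ∀ w, w ≠ 0 → 0 < fderiv ℝ (fderiv ℝ H) z₀ w w) :
    ∃ κ > 0, ∀ᶠ r in 𝓝[>] (0 : ℝ), ∀ z ∈ closedBall z₀ r, H z₀ + κ * dist z z₀ ^ 2 ≤ H z := by
  obtain ⟨m, hm, hmin⟩ : ∃ m > 0, ∀ w, m * ‖w‖ ^ 2 ≤ fderiv ℝ (fderiv ℝ H) z₀ w w := by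
    rcases (sphere (0 : E) 1).eq_empty_or_nonempty with hem | hne
    · refine ⟨1, one_pos, fun w => ?_⟩
      by_cases hw : w = 0
      · simp [hw]
      · have : ‖w‖⁻¹ • w ∈ sphere (0 : E) 1 := by
          simp [norm_smul, inv_mul_cancel₀ (norm_ne_zero_iff.mpr hw)]
        simp [hem] at this
    · obtain ⟨v, hv, hvm⟩ := (isCompact_sphere (0 : E) 1).exists_isMinOn hne
        (f := fun w => fderiv ℝ (fderiv ℝ H) z₀ w w) (by fun_prop)
      have hv0 : v ≠ 0 := by
        rintro rfl
        simp at hv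
      refine ⟨_, h2 v hv0, fun w => ?_⟩
      by_cases hw : w = 0
      · simp [hw]
      · have hn := norm_ne_zero_iff.mpr hw
        have hs : ‖w‖⁻¹ • w ∈ sphere (0 : E) 1 := by
          simp [norm_smul, inv_mul_cancel₀ hn]
        have h := hvm hs
        simp only [map_smul, smul_apply, smul_eq_mul, mem_ofPred_eq] at h
        calc _ ≤ ‖w‖⁻¹ * (‖w‖⁻¹ * fderiv ℝ (fderiv ℝ H) z₀ w w) * ‖w‖ ^ 2 := by gcongr
          _ = _ := by field_simp
  refine ⟨m / 4, by positivity, ?_⟩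
  have hd : ∀ᶠ z in 𝓝 z₀, DifferentiableAt ℝ H z :=
    (hH.eventually (by simp)).mono fun z hz => hz.differentiableAt (by simp)
  have hd2 : HasFDerivAt (fderiv ℝ H) (fderiv ℝ (fderiv ℝ H) z₀) z₀ :=
    ((hH.fderiv_right (m := 1) (by norm_num)).differentiableAt (by simp)).hasFDerivAt
  obtain ⟨R, hR, hball⟩ := Metric.eventually_nhds_iff.mp
    (hd.and (hd2.isLittleO.def (show 0 < m / 2 by positivity)))
  filter_upwards [Ioo_mem_nhdsGT hR] with r hr z hz
  obtain ⟨w, rfl⟩ : ∃ w, z = z₀ + w := ⟨z - z₀, by simp⟩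
  have hwR : ‖w‖ < R := lt_of_le_of_lt (by simpa [mem_closedBall, dist_eq_norm] using hz) hr.2
  have hin : ∀ t ∈ Icc (0 : ℝ) 1, dist (z₀ + t • w) z₀ < R := by
    intro t ht
    rw [dist_eq_norm, add_sub_cancel_left, norm_smul, Real.norm_of_nonneg ht.1]
    exact lt_of_le_of_lt (mul_le_of_le_one_left (norm_nonneg _) ht.2) hwR
  have hg : ∀ t ∈ Icc (0 : ℝ) 1, HasDerivAt (fun t : ℝ => H (z₀ + t • w) - m / 4 * ‖w‖ ^ 2 * t ^ 2)
      (fderiv ℝ H (z₀ + t • w) w - m / 4 * ‖w‖ ^ 2 * (2 * t)) t := by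
    intro t ht
    have hline : HasDerivAt (fun t : ℝ => z₀ + t • w) w t := by
      simpa using ((hasDerivAt_id t).smul_const w).const_add z₀
    refine ((hball (hin t ht)).1.hasFDerivAt.comp_hasDerivAt t hline).sub ?_
    simpa using (hasDerivAt_pow 2 t).const_mul (m / 4 * ‖w‖ ^ 2)
  have hmono := monotoneOn_of_deriv_nonneg (convex_Icc (0 : ℝ) 1)
    (fun t ht => (hg t ht).continuousAt.continuousWithinAt)
    (fun t ht => (hg t (interior_subset ht)).differentiableAt.differentiableWithinAt)
    (fun t ht => by
      rw [interior_Icc] at ht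
      rw [(hg t (Ioo_subset_Icc_self ht)).deriv]
      have hb := (hball (hin t (Ioo_subset_Icc_self ht))).2
      rw [h1, add_sub_cancel_left, sub_zero] at hb
      have hb2 := ContinuousLinearMap.le_of_opNorm_le _ hb w
      rw [Real.norm_eq_abs, sub_apply, abs_le] at hb2
      simp only [map_smul, smul_apply, smul_eq_mul, norm_smul,
        Real.norm_of_nonneg ht.1.le] at hb2
      nlinarith [mul_le_mul_of_nonneg_left (hmin w) ht.1.le, hb2.1])
  have := hmono (left_mem_Icc.mpr zero_le_one) (right_mem_Icc.mpr zero_le_one) zero_le_one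
  simp only [zero_smul, add_zero, one_smul] at this
  rw [dist_eq_norm, add_sub_cancel_left]
  linarith

end SecondOrder

/-! ### Hamiltonian vector fields -/

section Hamiltonian

open Set Metric Filter Topology

variable {ι : Type*} [Fintype ι] [DecidableEq ι] {H : (ι → ℝ) × (ι → ℝ) → ℝ}
  {z₀ : (ι → ℝ) × (ι → ℝ)}

theorem apply_prod_pi (L : (ι → ℝ) × (ι → ℝ) →L[ℝ] ℝ) (x y : ι → ℝ) :
    L (x, y) = ∑ i, x i * L (Pi.single i 1, 0) + ∑ i, y i * L (0, Pi.single i 1) := by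
  have hx : x = ∑ i, x i • (Pi.single i 1 : ι → ℝ) := by
    funext j; simp [Finset.sum_apply, Pi.single_apply]
  have hy : y = ∑ i, y i • (Pi.single i 1 : ι → ℝ) := by
    funext j; simp [Finset.sum_apply, Pi.single_apply]
  have h1 : L (x, y) = L.comp (ContinuousLinearMap.inl ℝ _ _) x +
      L.comp (ContinuousLinearMap.inr ℝ _ _) y := by
    simp [← map_add]
  rw [h1]
  conv_lhs => rw [hx, hy]
  simp [map_sum]

/-- Conservation of energy. -/
theorem fderiv_hamiltonianVectorField_eq_zero (H : (ι → ℝ) × (ι → ℝ) → ℝ)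
    (z : (ι → ℝ) × (ι → ℝ)) : fderiv ℝ H z (hamiltonianVectorField H z) = 0 := by
  rw [hamiltonianVectorField, apply_prod_pi, ← Finset.sum_add_distrib]
  exact Finset.sum_eq_zero fun i _ => by ring

theorem contDiffAt_hamiltonianVectorField (hH : ContDiffAt ℝ 2 H z₀) :
    ContDiffAt ℝ 1 (hamiltonianVectorField H) z₀ := by
  have h := hH.fderiv_right (m := 1) (by norm_num)
  refine ContDiffAt.prodMk (contDiffAt_pi.mpr fun i => ?_) (contDiffAt_pi.mpr fun i => ?_)
  · exact h.clm_apply contDiffAt_const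
  · exact (h.clm_apply contDiffAt_const).neg

/-- The linearization of a Hamiltonian vector field, in terms of the second derivative of the
Hamiltonian. -/
theorem exists_hasFDerivAt_hamiltonianVectorField (hH : ContDiffAt ℝ 2 H z₀) :
    ∃ L : (ι → ℝ) × (ι → ℝ) →L[ℝ] (ι → ℝ) × (ι → ℝ),
      HasFDerivAt (hamiltonianVectorField H) L z₀ ∧ ∀ w, L w =
        (fun i => fderiv ℝ (fderiv ℝ H) z₀ w (0, Pi.single i 1),
          fun i => - fderiv ℝ (fderiv ℝ H) z₀ w (Pi.single i 1, 0)) := by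
  have h := ((hH.fderiv_right (m := 1) (by norm_num)).differentiableAt (by simp)).hasFDerivAt
  let B := fderiv ℝ (fderiv ℝ H) z₀
  have hB : ∀ v, HasFDerivAt (fun z => fderiv ℝ H z v) (B.flip v) z₀ := by
    intro v
    simpa using h.clm_apply (hasFDerivAt_const v z₀)
  refine ⟨(ContinuousLinearMap.pi fun i => B.flip (0, Pi.single i 1)).prod
    (ContinuousLinearMap.pi fun i => -B.flip (Pi.single i 1, 0)), ?_, fun w => ?_⟩
  · exact (hasFDerivAt_pi.mpr fun i => hB _).prodMk (hasFDerivAt_pi.mpr fun i => (hB _).neg)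
  · rfl

/-- A real eigenvector is an eigenvector of the complexification. -/
theorem hasEigenvalue_baseChange_complex {E : Type*} [NormedAddCommGroup E] [NormedSpace ℝ E]
    {L : E →L[ℝ] E} {μ : ℝ} {w : E} (hw : w ≠ 0) (h : L w = μ • w) :
    Module.End.HasEigenvalue ((L : E →ₗ[ℝ] E).baseChange ℂ) (μ : ℂ) := by
  refine Module.End.hasEigenvalue_of_hasEigenvector (x := (1 : ℂ) ⊗ₜ[ℝ] w) ⟨?_, ?_⟩
  · rw [Module.End.mem_eigenspace_iff, LinearMap.baseChange_tmul, ContinuousLinearMap.coe_coe, h,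
      TensorProduct.smul_tmul', ← TensorProduct.smul_tmul]
    simp
  · intro h0
    have := congrArg ((TensorProduct.lid ℝ E).toLinearMap ∘ₗ LinearMap.rTensor E Complex.reLm) h0
    simp at this
    exact hw this

/-- The Lagrange–Dirichlet criterion: an equilibrium with positive definite second derivative of
the Hamiltonian is stable. -/
theorem isLyapunovStable_of_posDef {D : Set ((ι → ℝ) × (ι → ℝ))} (hD : D ∈ 𝓝 z₀)
    (hH : ContDiffAt ℝ 2 H z₀) (h1 : fderiv ℝ H z₀ = 0)
    (h2 : ∀ w, w ≠ 0 → 0 < fderiv ℝ (fderiv ℝ H) z₀ w w) :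
    IsLyapunovStable D (hamiltonianVectorField H) z₀ := by
  obtain ⟨κ, hκ, hgrow⟩ := exists_quadratic_growth hH h1 h2
  have hd : ∀ᶠ z in 𝓝 z₀, DifferentiableAt ℝ H z :=
    (hH.eventually (by simp)).mono fun z hz => hz.differentiableAt (by simp)
  obtain ⟨R, hR, hball⟩ := Metric.eventually_nhds_iff.mp (hd.and hD)
  obtain ⟨r, hr, hrR⟩ := (hgrow.and (Ioo_mem_nhdsGT hR)).exists
  have hsub : ∀ z ∈ closedBall z₀ r, DifferentiableAt ℝ H z ∧ z ∈ D := fun z hz =>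
    hball (lt_of_le_of_lt hz hrR.2)
  refine isLyapunovStable_of_quadratic_growth hrR.1 hκ (contDiffAt_hamiltonianVectorField hH) ?_
    (fun z hz => (hsub z hz).2) (fun z hz => (hsub z hz).1)
    (fun z _ => fderiv_hamiltonianVectorField_eq_zero H z) hr
  simp only [hamiltonianVectorField, h1]
  ext <;> simp

end Hamiltonian

/-! ### The potential near a configuration on the equator -/

section Potential

open Set Filter Topology

theorem cot_arccos {x : ℝ} (h1 : -1 ≤ x) (h2 : x ≤ 1) :
    Real.cot (Real.arccos x) = x / √(1 - x ^ 2) := by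
  rw [Real.cot_eq_cos_div_sin, Real.cos_arccos h1 h2, Real.sin_arccos]

theorem one_sub_sq_pos {x : ℝ} (hx : x ∈ Ioo (-1 : ℝ) 1) : 0 < 1 - x ^ 2 := by
  nlinarith [hx.1, hx.2]

theorem hasDerivAt_sqrt_one_sub_sq {x : ℝ} (hx : x ∈ Ioo (-1 : ℝ) 1) :
    HasDerivAt (fun x : ℝ => √(1 - x ^ 2)) (-x / √(1 - x ^ 2)) x := by
  refine (((hasDerivAt_pow 2 x).const_sub 1).sqrt (one_sub_sq_pos hx).ne').congr_deriv ?_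
  have := (Real.sqrt_pos.mpr (one_sub_sq_pos hx)).ne'
  field_simp
  simp

theorem hasDerivAt_cot_arccos {x : ℝ} (hx : x ∈ Ioo (-1 : ℝ) 1) :
    HasDerivAt (fun x => Real.cot (Real.arccos x)) ((√(1 - x ^ 2) ^ 3)⁻¹) x := by
  have hs := Real.sqrt_pos.mpr (one_sub_sq_pos hx)
  have hsq := Real.sq_sqrt (one_sub_sq_pos hx).le
  have h : HasDerivAt (fun x : ℝ => x / √(1 - x ^ 2)) ((√(1 - x ^ 2) ^ 3)⁻¹) x := by
    refine ((hasDerivAt_id x).div (hasDerivAt_sqrt_one_sub_sq hx) hs.ne').congr_deriv ?_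
    simp only [id]
    field_simp
    rw [hsq]
    ring
  refine h.congr_of_eventuallyEq ?_
  filter_upwards [isOpen_Ioo.mem_nhds hx] with y hy using cot_arccos hy.1.le hy.2.le

theorem hasDerivAt_inv_sqrt_one_sub_sq_pow {x : ℝ} (hx : x ∈ Ioo (-1 : ℝ) 1) :
    HasDerivAt (fun x : ℝ => (√(1 - x ^ 2) ^ 3)⁻¹) (3 * x / √(1 - x ^ 2) ^ 5) x := by
  have hs := Real.sqrt_pos.mpr (one_sub_sq_pos hx)
  refine (((hasDerivAt_sqrt_one_sub_sq hx).pow 3).inv (pow_ne_zero 3 hs.ne')).congr_deriv ?_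
  simp only [Pi.pow_apply]
  field_simp
  norm_num
  ring

/-- The cosine of the spherical distance of the particles `i` and `j`, in coordinates. -/
def pairCos {N : ℕ} (q : Config N) (i j : Fin (N + 1)) : ℝ :=
  Real.sin (q (Sum.inr i)) * Real.sin (q (Sum.inr j)) *
      Real.cos (q (Sum.inl i) - q (Sum.inl j)) +
    Real.cos (q (Sum.inr i)) * Real.cos (q (Sum.inr j))

theorem inner_position {N : ℕ} (q : Config N) (i j : Fin (N + 1)) :
    inner ℝ (position q i) (position q j) = pairCos q i j := by
  simp only [position, spherePoint, pairCos, Real.cos_sub]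
  simp [PiLp.inner_apply, Fin.sum_univ_three]
  ring

theorem potential_eq {N : ℕ} (q : Config N) :
    potential q = ∑ i, ∑ j ∈ Finset.Ioi i, Real.cot (Real.arccos (pairCos q i j)) := by
  simp only [potential, sphereDist, inner_position]

theorem isRegular_of_pairCos {N : ℕ} {q : Config N}
    (h1 : ∀ i, 0 < q (Sum.inr i) ∧ q (Sum.inr i) < Real.pi)
    (h2 : ∀ i j, i ≠ j → pairCos q i j ∈ Ioo (-1 : ℝ) 1) : IsRegular q := by
  refine ⟨h1, fun i j hij => ⟨fun h => ?_, fun h => ?_⟩⟩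
  all_goals
    have hj : pairCos q j j = 1 := by
      simp only [pairCos, sub_self, Real.cos_zero]
      nlinarith [Real.sin_sq_add_cos_sq (q (Sum.inr j))]
    have h3 := h2 i j hij
    rw [← inner_position, h] at h3
    rw [← inner_position] at hj
    simp only [inner_neg_left, hj] at h3
    linarith [h3.1, h3.2]

/-- The particles lie on the equator, pairwise distinct and not antipodal. -/
def IsEquatorial {N : ℕ} (q : Config N) : Prop :=
  (∀ i, q (Sum.inr i) = Real.pi / 2) ∧
    ∀ i j, i ≠ j → Real.sin (q (Sum.inl i) - q (Sum.inl j)) ≠ 0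

namespace IsEquatorial

variable {N : ℕ} {q : Config N}

theorem pairCos_eq (hq : IsEquatorial q) (i j : Fin (N + 1)) :
    pairCos q i j = Real.cos (q (Sum.inl i) - q (Sum.inl j)) := by
  simp [pairCos, hq.1]

theorem cos_mem_Ioo (hq : IsEquatorial q) {i j : Fin (N + 1)} (hij : i ≠ j) :
    Real.cos (q (Sum.inl i) - q (Sum.inl j)) ∈ Ioo (-1 : ℝ) 1 := by
  have h := sq_pos_of_ne_zero (hq.2 i j hij)
  have h2 := Real.sin_sq_add_cos_sq (q (Sum.inl i) - q (Sum.inl j))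
  exact abs_lt.mp ((sq_lt_one_iff_abs_lt_one _).mp (by linarith))

theorem pairCos_mem_Ioo (hq : IsEquatorial q) {i j : Fin (N + 1)} (hij : i ≠ j) :
    pairCos q i j ∈ Ioo (-1 : ℝ) 1 := by
  rw [hq.pairCos_eq]; exact hq.cos_mem_Ioo hij

theorem isRegular_eventually (hq : IsEquatorial q) : ∀ᶠ q' in 𝓝 q, IsRegular q' := by
  have h1 : ∀ i, ∀ᶠ q' in 𝓝 q, 0 < q' (Sum.inr i) ∧ q' (Sum.inr i) < Real.pi := by
    intro i
    have hc : ContinuousAt (fun q' : Config N => q' (Sum.inr i)) q :=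
      (continuous_apply _).continuousAt
    refine hc.eventually (Ioo_mem_nhds ?_ ?_) <;> simp only [hq.1] <;> linarith [Real.pi_pos]
  have h2 : ∀ i j, ∀ᶠ q' in 𝓝 q, i ≠ j → pairCos q' i j ∈ Ioo (-1 : ℝ) 1 := by
    intro i j
    by_cases hij : i = j
    · exact Eventually.of_forall fun _ h => absurd hij h
    · have hc : ContinuousAt (fun q' : Config N => pairCos q' i j) q := by
        unfold pairCos; fun_prop
      filter_upwards [hc.eventually (isOpen_Ioo.mem_nhds (hq.pairCos_mem_Ioo hij))] with q' h _
        using h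
  filter_upwards [eventually_all.mpr h1, eventually_all.mpr fun i => eventually_all.mpr (h2 i)]
    with q' h1 h2 using isRegular_of_pairCos h1 h2

theorem contDiffAt_hamiltonian (hq : IsEquatorial q) (y : Config N) {n : WithTop ℕ∞} :
    ContDiffAt ℝ n (hamiltonian (N := N)) (q, y) := by
  unfold hamiltonian
  simp only [potential_eq]
  refine ContDiffAt.sub (ContDiffAt.sum fun i _ => ContDiffAt.add (ContDiffAt.div ?_ ?_ ?_) ?_)
    (ContDiffAt.sum fun i _ => ContDiffAt.sum fun j hj => ?_)
  · fun_prop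
  · have : ContDiff ℝ n (fun x : Phase N => x.1 (Sum.inr i)) := by fun_prop
    exact (contDiff_const.mul (this.sin.pow 2)).contDiffAt
  · simp [hq.1]
  · fun_prop
  · have hmem := hq.pairCos_mem_Ioo (Finset.mem_Ioi.mp hj).ne
    have hc : ContDiffAt ℝ n (fun x : Phase N => pairCos x.1 i j) (q, y) := by
      have h1 : ∀ k, ContDiff ℝ n (fun x : Phase N => x.1 k) := fun k => by fun_prop
      unfold pairCos
      exact ((((h1 _).sin.mul (h1 _).sin).mul ((h1 _).sub (h1 _)).cos).add
        ((h1 _).cos.mul (h1 _).cos)).contDiffAt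
    have ha : ContDiffAt ℝ n (fun x : Phase N => Real.arccos (pairCos x.1 i j)) (q, y) :=
      ContDiffAt.comp (g := Real.arccos) (q, y)
        (Real.contDiffAt_arccos hmem.1.ne' hmem.2.ne) hc
    simp only [Real.cot_eq_cos_div_sin]
    refine ha.cos.div ha.sin ?_
    change Real.sin (Real.arccos (pairCos q i j)) ≠ 0
    rw [Real.sin_arccos]
    exact (Real.sqrt_pos.mpr (one_sub_sq_pos hmem)).ne'

/-- The Taylor expansion of the pair potential at the equator: `2 cos / |sin|³` is the second
derivative of `cot d`, and there are no mixed terms between `φ` and `θ`. -/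
theorem hasTwoJet_cot (hq : IsEquatorial q) (w : Config N) {i j : Fin (N + 1)} (hij : i ≠ j) :
    HasTwoJet (fun t : ℝ => Real.cot (Real.arccos (pairCos (q + t • w) i j)))
      (Real.cot (Real.arccos (pairCos q i j)))
      (-(Real.sin (q (Sum.inl i) - q (Sum.inl j)) /
          |Real.sin (q (Sum.inl i) - q (Sum.inl j))| ^ 3 * (w (Sum.inl i) - w (Sum.inl j))))
      (2 * (Real.cos (q (Sum.inl i) - q (Sum.inl j)) /
          |Real.sin (q (Sum.inl i) - q (Sum.inl j))| ^ 3 * (w (Sum.inl i) - w (Sum.inl j)) ^ 2) +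
        (2 * w (Sum.inr i) * w (Sum.inr j) - Real.cos (q (Sum.inl i) - q (Sum.inl j)) *
            (w (Sum.inr i) ^ 2 + w (Sum.inr j) ^ 2)) /
          |Real.sin (q (Sum.inl i) - q (Sum.inl j))| ^ 3) := by
  have hθ : ∀ k, HasTwoJet (fun t : ℝ => (q + t • w) (Sum.inr k)) (Real.pi / 2)
      (w (Sum.inr k)) 0 := fun k =>
    (HasTwoJet.affine (Real.pi / 2) (w (Sum.inr k))).congr (fun t => by simp [hq.1]) rfl rfl rfl
  have hφ : ∀ k, HasTwoJet (fun t : ℝ => (q + t • w) (Sum.inl k)) (q (Sum.inl k))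
      (w (Sum.inl k)) 0 := fun k =>
    (HasTwoJet.affine (q (Sum.inl k)) (w (Sum.inl k))).congr (fun t => by simp) rfl rfl rfl
  have hc := ((((hθ i).sin.mul (hθ j).sin).mul ((hφ i).sub (hφ j)).cos).add
    ((hθ i).cos.mul (hθ j).cos))
  have hval : Real.sin (Real.pi / 2) * Real.sin (Real.pi / 2) *
      Real.cos (q (Sum.inl i) - q (Sum.inl j)) + Real.cos (Real.pi / 2) * Real.cos (Real.pi / 2) =
      Real.cos (q (Sum.inl i) - q (Sum.inl j)) := by simp
  rw [hval] at hc
  have hmem := hq.cos_mem_Ioo hij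
  have hs := hq.2 i j hij
  have hsc := Real.sin_sq_add_cos_sq (q (Sum.inl i) - q (Sum.inl j))
  have hroot : √(1 - Real.cos (q (Sum.inl i) - q (Sum.inl j)) ^ 2) =
      |Real.sin (q (Sum.inl i) - q (Sum.inl j))| := by
    rw [← Real.sqrt_sq_eq_abs]
    congr 1
    linarith
  refine (hc.comp (F := fun x => Real.cot (Real.arccos x)) (F' := fun x => (√(1 - x ^ 2) ^ 3)⁻¹)
    (by filter_upwards [isOpen_Ioo.mem_nhds hmem] with x hx using hasDerivAt_cot_arccos hx)
    (hasDerivAt_inv_sqrt_one_sub_sq_pow hmem)).congr (fun t => by simp only [pairCos])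
    (by rw [hq.pairCos_eq]) ?_ ?_
  all_goals
    simp only [hroot, Real.sin_pi_div_two, Real.cos_pi_div_two]
    have ha := abs_pos.mpr hs
    have hsq := sq_abs (Real.sin (q (Sum.inl i) - q (Sum.inl j)))
    rw [← hsq] at hsc
  · ring
  · field_simp
    linear_combination -(3 * Real.cos (q (Sum.inl i) - q (Sum.inl j)) *
      (w (Sum.inl i) - w (Sum.inl j)) ^ 2) * hsq

/-- The Taylor expansion of the Hamiltonian at a state on the equator in which all particles have
the angular velocity `α`. -/
theorem hasTwoJet_hamiltonian (hq : IsEquatorial q) (α : ℝ) (w : Phase N) :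
    HasTwoJet (fun t : ℝ => hamiltonian ((q, Sum.elim (fun _ => α) (fun _ => 0)) + t • w))
      (hamiltonian (q, Sum.elim (fun _ => α) (fun _ => 0)))
      (α * momentum w +
        ∑ i, ∑ j ∈ Finset.Ioi i, Real.sin (q (Sum.inl i) - q (Sum.inl j)) /
          |Real.sin (q (Sum.inl i) - q (Sum.inl j))| ^ 3 * (w.1 (Sum.inl i) - w.1 (Sum.inl j)))
      (∑ i, w.2 (Sum.inl i) ^ 2 + ∑ i, w.2 (Sum.inr i) ^ 2 + α ^ 2 * ∑ i, w.1 (Sum.inr i) ^ 2 -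
        ∑ i, ∑ j ∈ Finset.Ioi i, (2 * (Real.cos (q (Sum.inl i) - q (Sum.inl j)) /
          |Real.sin (q (Sum.inl i) - q (Sum.inl j))| ^ 3 *
            (w.1 (Sum.inl i) - w.1 (Sum.inl j)) ^ 2) +
        (2 * w.1 (Sum.inr i) * w.1 (Sum.inr j) - Real.cos (q (Sum.inl i) - q (Sum.inl j)) *
            (w.1 (Sum.inr i) ^ 2 + w.1 (Sum.inr j) ^ 2)) /
          |Real.sin (q (Sum.inl i) - q (Sum.inl j))| ^ 3)) := by
  have hpot := HasTwoJet.sum (s := Finset.univ) fun i _ => HasTwoJet.sum (s := Finset.Ioi i)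
    fun j hj => hq.hasTwoJet_cot w.1 (Finset.mem_Ioi.mp hj).ne
  have hkin : ∀ i, HasTwoJet (fun t : ℝ => (α + t * w.2 (Sum.inl i)) * (α + t * w.2 (Sum.inl i)) *
      (2 * (Real.sin (Real.pi / 2 + t * w.1 (Sum.inr i)) *
        Real.sin (Real.pi / 2 + t * w.1 (Sum.inr i))))⁻¹ +
      2⁻¹ * ((0 + t * w.2 (Sum.inr i)) * (0 + t * w.2 (Sum.inr i)))) (α ^ 2 / 2)
      (α * w.2 (Sum.inl i))
      (w.2 (Sum.inl i) ^ 2 + w.2 (Sum.inr i) ^ 2 + α ^ 2 * w.1 (Sum.inr i) ^ 2) := by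
    intro i
    have h1 := HasTwoJet.affine α (w.2 (Sum.inl i))
    have h2 := (HasTwoJet.affine (Real.pi / 2) (w.1 (Sum.inr i))).sin
    have h3 := HasTwoJet.affine 0 (w.2 (Sum.inr i))
    refine (((h1.mul h1).mul (((HasTwoJet.const 2).mul (h2.mul h2)).inv (by simp))).add
      ((HasTwoJet.const 2⁻¹).mul (h3.mul h3))).congr (fun t => rfl) ?_ ?_ ?_ <;>
    · simp only [Real.sin_pi_div_two, Real.cos_pi_div_two]
      ring
  refine ((HasTwoJet.sum (s := Finset.univ) fun i _ => hkin i).sub hpot).congr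
    (fun t => ?_) ?_ ?_ ?_
  · simp only [hamiltonian, potential_eq]
    simp [hq.1]
    refine Finset.sum_congr rfl fun i _ => ?_
    ring
  · simp [hamiltonian, potential_eq, hq.1]
  · simp [momentum, Finset.mul_sum]
  · simp only [Finset.sum_add_distrib, Finset.mul_sum]

end IsEquatorial

end Potential

/-! ### Circulant quadratic forms -/

section Circulant

open Finset

variable {n : ℕ}

/-- The angle `2π r / n ∈ [0, 2π)` of the residue class `r`. -/
def zmodAngle (r : ZMod n) : ℝ := (r.val : ℝ) * (2 * Real.pi / n)

@[simp]
theorem zmodAngle_zero : zmodAngle (0 : ZMod n) = 0 := by simp [zmodAngle]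

variable [NeZero n]

theorem zmodAngle_sub_sub (i j : ZMod n) :
    ∃ m : ℤ, zmodAngle i - zmodAngle j = zmodAngle (i - j) + m * (2 * Real.pi) := by
  have h : (((i.val : ℤ) - j.val - (i - j).val : ℤ) : ZMod n) = 0 := by
    push_cast
    simp
  obtain ⟨m, hm⟩ := (ZMod.intCast_zmod_eq_zero_iff_dvd _ n).mp h
  refine ⟨m, ?_⟩
  have hm' : (i.val : ℝ) - j.val - (i - j).val = n * m := by exact_mod_cast hm
  have hn : (n : ℝ) ≠ 0 := by exact_mod_cast NeZero.ne n
  have hi : (i.val : ℝ) = j.val + (i - j).val + n * m := by linarith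
  unfold zmodAngle
  rw [hi]
  field_simp
  ring

theorem _root_.Function.Periodic.apply_zmodAngle_sub {P : ℝ → ℝ}
    (hP : Function.Periodic P (2 * Real.pi)) (i j : ZMod n) :
    P (zmodAngle i - zmodAngle j) = P (zmodAngle (i - j)) := by
  obtain ⟨m, hm⟩ := zmodAngle_sub_sub i j
  rw [hm]
  exact hP.int_mul m _

theorem sum_apply_zmodAngle_sub_mul {P : ℝ → ℝ} (hP : Function.Periodic P (2 * Real.pi))
    (F : ZMod n → ℝ) (i : ZMod n) :
    ∑ j, P (zmodAngle i - zmodAngle j) * F j = ∑ r, P (zmodAngle r) * F (i - r) := by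
  simp only [hP.apply_zmodAngle_sub]
  exact Fintype.sum_equiv (Equiv.subLeft i) _ _ fun j => by simp

theorem sum_zmodAngle_eq_zero_of_odd {P : ℝ → ℝ} (hP : Function.Periodic P (2 * Real.pi))
    (hodd : ∀ x, P (-x) = -P x) : ∑ r : ZMod n, P (zmodAngle r) = 0 := by
  have h : ∑ r : ZMod n, P (zmodAngle r) = -∑ r : ZMod n, P (zmodAngle r) := by
    rw [← sum_neg_distrib]
    refine Fintype.sum_equiv (Equiv.neg _) _ _ fun r => ?_
    rw [Equiv.neg_apply, ← zero_sub r, ← hP.apply_zmodAngle_sub, zmodAngle_zero, zero_sub, hodd,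
      neg_neg]
  linarith

/-- For odd `n` the residues other than `0` come in pairs `± s`, `1 ≤ s ≤ p`. -/
theorem sum_zmodAngle_of_even {p : ℕ} {P : ℝ → ℝ} (hP : Function.Periodic P (2 * Real.pi))
    (heven : ∀ x, P (-x) = P x) : ∑ r : ZMod (2 * p + 1), P (zmodAngle r) =
      P 0 + 2 * ∑ s ∈ Icc 1 p, P (s * (2 * Real.pi / (2 * p + 1))) := by
  have h1 : ∑ r : ZMod (2 * p + 1), P (zmodAngle r) =
      ∑ s ∈ range (2 * p + 1), P (s * (2 * Real.pi / (2 * p + 1))) := by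
    rw [← Fin.sum_univ_eq_sum_range (fun s : ℕ => P (s * (2 * Real.pi / (2 * p + 1))))]
    refine Fintype.sum_congr _ _ fun r : Fin (2 * p + 1) => ?_
    simp only [zmodAngle]
    push_cast
    rfl
  have hn : (2 * (p : ℝ) + 1) ≠ 0 := by positivity
  have hrefl : ∑ s ∈ Icc (p + 1) (2 * p), P (s * (2 * Real.pi / (2 * p + 1))) =
      ∑ s ∈ Icc 1 p, P (s * (2 * Real.pi / (2 * p + 1))) := by
    refine sum_bij' (fun s _ => 2 * p + 1 - s) (fun s _ => 2 * p + 1 - s) ?_ ?_ ?_ ?_ ?_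
    any_goals intro s hs; simp only [mem_Icc] at hs ⊢; omega
    intro s hs
    simp only [mem_Icc] at hs
    rw [Nat.cast_sub (by omega), ← heven, ← hP]
    congr 1
    push_cast
    field_simp
    ring
  have hsplit : range (2 * p + 1) = insert 0 (Icc 1 p ∪ Icc (p + 1) (2 * p)) := by
    ext s
    simp only [mem_range, mem_insert, mem_union, mem_Icc]
    omega
  rw [h1, hsplit, sum_insert (by simp), sum_union, hrefl]
  · simp only [Nat.cast_zero, zero_mul]
    ring
  · rw [disjoint_left]
    intro s h1 h2
    simp only [mem_Icc] at h1 h2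
    omega

/-- The discrete Fourier transform of a real sequence, without normalization and with the character
`e^{2πi jk/n}` (not its inverse). -/
def dft (w : ZMod n → ℝ) (k : ZMod n) : ℂ := ∑ j, (w j : ℂ) * ZMod.stdAddChar (j * k)

theorem stdAddChar_mul_re (r k : ZMod n) :
    (ZMod.stdAddChar (r * k) : ℂ).re = Real.cos (k.val * zmodAngle r) := by
  have h : r * k = (((r.val * k.val : ℕ) : ℤ) : ZMod n) := by simp
  rw [h, ZMod.stdAddChar_coe]
  have h2 : 2 * (Real.pi : ℂ) * Complex.I * (((r.val * k.val : ℕ) : ℤ) : ℂ) / (n : ℂ) =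
      ((k.val * zmodAngle r : ℝ) : ℂ) * Complex.I := by
    unfold zmodAngle
    push_cast
    ring
  rw [h2, Complex.exp_ofReal_mul_I_re]

/-- The autocorrelation of a sequence from its power spectrum. -/
theorem sum_normSq_dft_mul (w : ZMod n → ℝ) (r : ZMod n) :
    ∑ k, Complex.normSq (dft w k) * Real.cos (k.val * zmodAngle r) =
      n * ∑ i, w i * w (i - r) := by
  have hconj : ∀ x : ZMod n, (starRingEnd ℂ) (ZMod.stdAddChar x) = ZMod.stdAddChar (-x) := by
    intro x
    exact (AddChar.map_neg_eq_conj _ x).symm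
  have hk : ∀ k, (Complex.normSq (dft w k) : ℂ) * ZMod.stdAddChar (r * k) =
      ∑ i, ∑ j, (w i : ℂ) * w j * ZMod.stdAddChar (k * (j - i + r)) := by
    intro k
    rw [Complex.normSq_eq_conj_mul_self, dft, map_sum, sum_mul_sum, sum_mul]
    refine sum_congr rfl fun i _ => ?_
    rw [sum_mul]
    refine sum_congr rfl fun j _ => ?_
    rw [map_mul, Complex.conj_ofReal, hconj,
      show k * (j - i + r) = -(i * k) + j * k + r * k by ring, AddChar.map_add_eq_mul,
      AddChar.map_add_eq_mul]
    ring
  have hc : ∑ k, (Complex.normSq (dft w k) : ℂ) * ZMod.stdAddChar (r * k) =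
      ((n * ∑ i, w i * w (i - r) : ℝ) : ℂ) := by
    simp only [hk]
    rw [sum_comm]
    push_cast
    rw [mul_sum]
    refine sum_congr rfl fun i _ => ?_
    rw [sum_comm]
    simp only [← mul_sum, AddChar.sum_mulShift _ (ZMod.isPrimitive_stdAddChar n), ZMod.card]
    rw [sum_eq_single (i - r)]
    · simp
      ring
    · intro j _ hj
      rw [if_neg, Nat.cast_zero, mul_zero]
      intro h
      exact hj (by linear_combination h)
    · simp
  have := congrArg Complex.re hc
  rw [Complex.ofReal_re, Complex.re_sum] at this
  rw [← this]
  refine sum_congr rfl fun k _ => ?_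
  rw [Complex.re_ofReal_mul, stdAddChar_mul_re]

/-- Parseval's identity. -/
theorem sum_normSq_dft (w : ZMod n → ℝ) :
    ∑ k, Complex.normSq (dft w k) = n * ∑ i, w i ^ 2 := by
  simpa [pow_two] using sum_normSq_dft_mul w 0

/-- The Fourier transform diagonalizes circulant quadratic forms. -/
theorem sum_mul_sub_sq_eq (K : ZMod n → ℝ) (w : ZMod n → ℝ) :
    n * ∑ i, ∑ r, K r * (w i - w (i - r)) ^ 2 =
      2 * ∑ k : ZMod n, Complex.normSq (dft w k) *
        ∑ r, K r * (1 - Real.cos (k.val * zmodAngle r)) := by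
  have hr : ∀ r, n * ∑ i, (w i - w (i - r)) ^ 2 =
      2 * ∑ k : ZMod n, Complex.normSq (dft w k) * (1 - Real.cos (k.val * zmodAngle r)) := by
    intro r
    have h1 : ∑ i, w (i - r) ^ 2 = ∑ i, w i ^ 2 :=
      Fintype.sum_equiv (Equiv.subRight r) _ _ fun i => by simp
    simp only [mul_sub, mul_one, sum_sub_distrib, sum_normSq_dft_mul, sum_normSq_dft]
    have h2 : ∀ i, (w i - w (i - r)) ^ 2 = w i ^ 2 + w (i - r) ^ 2 - 2 * (w i * w (i - r)) :=
      fun i => by ring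
    simp only [h2, sum_sub_distrib, sum_add_distrib, h1, ← mul_sum]
    ring
  calc _ = ∑ r, K r * (n * ∑ i, (w i - w (i - r)) ^ 2) := by
        rw [sum_comm, mul_sum]
        refine sum_congr rfl fun r _ => ?_
        rw [← mul_sum]
        ring
    _ = ∑ r, ∑ k : ZMod n, 2 * (Complex.normSq (dft w k) *
          (K r * (1 - Real.cos (k.val * zmodAngle r)))) := by
        refine sum_congr rfl fun r _ => ?_
        rw [hr, mul_sum, mul_sum]
        exact sum_congr rfl fun k _ => by ring
    _ = _ := by
        rw [sum_comm]
        simp only [← mul_sum]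

/-- A circulant form is positive on sequences of mean zero if its eigenvalues other than that of
the constants are positive. -/
theorem sum_mul_sub_sq_pos {K : ZMod n → ℝ}
    (hK : ∀ k : ZMod n, k ≠ 0 → 0 < ∑ r, K r * (1 - Real.cos (k.val * zmodAngle r)))
    {w : ZMod n → ℝ} (hw : w ≠ 0) (hsum : ∑ i, w i = 0) :
    0 < ∑ i, ∑ r, K r * (w i - w (i - r)) ^ 2 := by
  have hn : (0 : ℝ) < n := by exact_mod_cast Nat.pos_of_neZero n
  refine pos_of_mul_pos_right ?_ hn.le
  rw [sum_mul_sub_sq_eq]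
  have h0 : dft w 0 = 0 := by
    simp only [dft, mul_zero, AddChar.map_zero_eq_one, mul_one]
    exact_mod_cast hsum
  have hnn : ∀ k ∈ (univ : Finset (ZMod n)), 0 ≤ Complex.normSq (dft w k) *
      ∑ r, K r * (1 - Real.cos (k.val * zmodAngle r)) := by
    intro k _
    by_cases hk : k = 0
    · simp [hk]
    · exact mul_nonneg (Complex.normSq_nonneg _) (hK k hk).le
  refine mul_pos two_pos ((sum_nonneg hnn).lt_of_ne fun heq => hw ?_)
  have hz := (sum_eq_zero_iff_of_nonneg hnn).mp heq.symm
  have hall : ∀ k, Complex.normSq (dft w k) = 0 := by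
    intro k
    by_cases hk : k = 0
    · simp [hk, h0]
    · exact (mul_eq_zero.mp (hz k (mem_univ k))).resolve_right (hK k hk).ne'
  have hpars := sum_normSq_dft w
  simp only [hall, sum_const_zero] at hpars
  have hsq : ∑ i, w i ^ 2 = 0 := (mul_eq_zero.mp hpars.symm).resolve_left hn.ne'
  funext i
  exact pow_eq_zero_iff two_ne_zero |>.mp
    ((sum_eq_zero_iff_of_nonneg fun i _ => sq_nonneg (w i)).mp hsq i (mem_univ i))

end Circulant

/-! ### The eigenvalues of the planar second variation -/

section Eigenvalues

open Finset

/-- A discrete convexity argument: if the second differences `4 g` of `f` are decreasing, the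
increments of `f` start with `2 g 0` and end with `0`, then they are positive before. -/
theorem pos_of_second_difference {f g : ℕ → ℝ} {p : ℕ} (h0 : f 0 = 0) (h1 : f 1 = 2 * g 0)
    (h2 : ∀ m, f (m + 2) - 2 * f (m + 1) + f m = 4 * g (m + 1)) (hp : f (p + 1) = f p)
    (hg : ∀ m < p, g (m + 1) < g m) {m : ℕ} (hm : 1 ≤ m) (hmp : m ≤ p) : 0 < f m := by
  have hD : ∀ m < p, 0 < f (m + 1) - f m := by
    intro m hm
    rcases lt_or_ge 0 (g m) with hpos | hneg
    · have : ∀ k ≤ m, 0 < g k → 0 < f (k + 1) - f k ∧ ∀ j ≤ k, 0 < g j := by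
        intro k
        induction k with
        | zero =>
          intro _ h
          refine ⟨by rw [h0, zero_add, h1]; linarith, fun j hj => ?_⟩
          rwa [Nat.le_zero.mp hj]
        | succ k ih =>
          intro hk h
          obtain ⟨i1, i2⟩ := ih (by omega) (h.trans (hg k (by omega)))
          refine ⟨by linarith [h2 k], fun j hj => ?_⟩
          rcases Nat.le_succ_iff.mp hj with hj | rfl
          · exact i2 j hj
          · exact h
      exact (this m le_rfl hpos).1
    · by_contra! hc
      have : ∀ k, m + 1 + k ≤ p → f (m + 1 + k + 1) - f (m + 1 + k) < 0 ∧ g (m + 1 + k) < 0 := by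
        intro k
        induction k with
        | zero =>
          intro _
          have := hg m hm
          exact ⟨by linarith [h2 m], by rw [add_zero]; linarith⟩
        | succ k ih =>
          intro hk
          obtain ⟨i1, i2⟩ := ih (by omega)
          have := hg (m + 1 + k) (by omega)
          have := h2 (m + 1 + k)
          simp only [← add_assoc] at *
          exact ⟨by linarith, by linarith⟩
      obtain ⟨k, rfl⟩ : ∃ k, p = m + 1 + k := ⟨p - (m + 1), by omega⟩
      linarith [(this k le_rfl).1]
  have : ∀ k, 1 + k ≤ p → 0 < f (1 + k) := by
    intro k
    induction k with
    | zero => intro hk; have := hD 0 (by omega); rw [h0] at this; simpa using this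
    | succ k ih =>
      intro hk
      have := hD (1 + k) (by omega)
      linarith [ih (by omega), show f (1 + (k + 1)) = f (1 + k + 1) from rfl]
  obtain ⟨k, rfl⟩ : ∃ k, m = 1 + k := ⟨m - 1, by omega⟩
  exact this k hmp

/-- The Dirichlet-type sum of sines, by telescoping. -/
theorem two_sin_half_mul_sum_sin (β : ℝ) (p : ℕ) :
    2 * Real.sin (β / 2) * ∑ s ∈ Icc 1 p, Real.sin (s * β) =
      Real.cos (β / 2) - Real.cos ((p + 1 / 2) * β) := by
  induction p with
  | zero => simp; ring_nf
  | succ p ih =>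
    rw [sum_Icc_succ_top (by omega), mul_add, ih]
    push_cast
    have e1 : ((p : ℝ) + 1 / 2) * β = (p + 1) * β - β / 2 := by ring
    have e2 : ((p : ℝ) + 1 + 1 / 2) * β = (p + 1) * β + β / 2 := by ring
    rw [e1, e2, Real.cos_sub, Real.cos_add]
    ring

variable {p : ℕ}

/-- The first `p` of the angles `2πs/n`, `n = 2p + 1`, lie in the upper half circle. -/
theorem polygonAngle_mem_Ioo {s : ℕ} (h1 : 1 ≤ s) (h2 : s ≤ p) :
    (s : ℝ) * (2 * Real.pi / (2 * p + 1)) ∈ Set.Ioo 0 Real.pi := by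
  have hs : (1 : ℝ) ≤ s := by exact_mod_cast h1
  have hs2 : (s : ℝ) ≤ p := by exact_mod_cast h2
  have hpi := Real.pi_pos
  have hn : (0 : ℝ) < 2 * p + 1 := by positivity
  constructor
  · positivity
  · rw [mul_div_assoc', div_lt_iff₀ hn]
    nlinarith

/-- With `β = 4πm/n` the closed form of the sum is `(cos (β/2) - 1) / (2 sin (β/2))`. -/
theorem sum_sin_neg {m : ℕ} (h1 : 1 ≤ m) (h2 : m ≤ p) :
    ∑ s ∈ Icc 1 p, Real.sin (2 * m * (s * (2 * Real.pi / (2 * p + 1)))) < 0 := by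
  have hn : (2 * (p : ℝ) + 1) ≠ 0 := by positivity
  have h := two_sin_half_mul_sum_sin (4 * m * Real.pi / (2 * p + 1)) p
  have e1 : (4 * m * Real.pi / (2 * p + 1)) / 2 = m * (2 * Real.pi / (2 * (p : ℝ) + 1)) := by ring
  have e2 : ((p : ℝ) + 1 / 2) * (4 * m * Real.pi / (2 * p + 1)) = m * (2 * Real.pi) := by
    field_simp
    ring
  have e3 : ∀ s : ℕ, (s : ℝ) * (4 * m * Real.pi / (2 * p + 1)) =
      2 * m * (s * (2 * Real.pi / (2 * p + 1))) := fun s => by ring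
  rw [e1, e2, Real.cos_nat_mul_two_pi] at h
  simp only [e3] at h
  have hm := polygonAngle_mem_Ioo h1 h2
  have hsin := Real.sin_pos_of_mem_Ioo hm
  have hcos : Real.cos (m * (2 * Real.pi / (2 * (p : ℝ) + 1))) < 1 := by
    have := Real.sin_sq_add_cos_sq (m * (2 * Real.pi / (2 * (p : ℝ) + 1)))
    nlinarith [Real.cos_le_one (m * (2 * Real.pi / (2 * (p : ℝ) + 1)))]
  by_contra! hc
  nlinarith [mul_nonneg hsin.le hc]

/-- Positivity of the planar eigenvalues with even index. The second differences in `m` of the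
sum are sums of cotangents times cosines, whose first differences are the geometric sums of
`sum_sin_neg`. -/
theorem planar_eigenvalue_pos {m : ℕ} (h1 : 1 ≤ m) (h2 : m ≤ p) :
    0 < ∑ s ∈ Icc 1 p, -(Real.cos (s * (2 * Real.pi / (2 * p + 1))) /
      Real.sin (s * (2 * Real.pi / (2 * p + 1))) ^ 3) *
        (1 - Real.cos (2 * m * (s * (2 * Real.pi / (2 * p + 1))))) := by
  have hn : (2 * (p : ℝ) + 1) ≠ 0 := by positivity
  have hs : ∀ s ∈ Icc 1 p, Real.sin (s * (2 * Real.pi / (2 * p + 1))) ≠ 0 := fun s hs =>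
    (Real.sin_pos_of_mem_Ioo (polygonAngle_mem_Ioo (mem_Icc.mp hs).1 (mem_Icc.mp hs).2)).ne'
  refine pos_of_second_difference
    (f := fun m : ℕ => ∑ s ∈ Icc 1 p, -(Real.cos (s * (2 * Real.pi / (2 * p + 1))) /
      Real.sin (s * (2 * Real.pi / (2 * p + 1))) ^ 3) *
        (1 - Real.cos (2 * m * (s * (2 * Real.pi / (2 * p + 1))))))
    (g := fun m : ℕ => ∑ s ∈ Icc 1 p, -(Real.cos (s * (2 * Real.pi / (2 * p + 1))) /
      Real.sin (s * (2 * Real.pi / (2 * p + 1)))) *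
        Real.cos (2 * m * (s * (2 * Real.pi / (2 * p + 1))))) ?_ ?_ ?_ ?_ ?_ h1 h2
  · simp
  · rw [mul_sum]
    refine sum_congr rfl fun s h => ?_
    have hs := hs s h
    generalize (s : ℝ) * (2 * Real.pi / (2 * p + 1)) = y at *
    simp only [Nat.cast_one, mul_one, Nat.cast_zero, mul_zero, zero_mul, Real.cos_zero]
    rw [Real.cos_two_mul, Real.cos_sq']
    field_simp
    ring
  · intro m
    rw [mul_sum, mul_sum, ← sum_sub_distrib, ← sum_add_distrib]
    refine sum_congr rfl fun s h => ?_
    have hs := hs s h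
    generalize (s : ℝ) * (2 * Real.pi / (2 * p + 1)) = y at *
    push_cast
    have e1 : 2 * ((m : ℝ) + 2) * y = 2 * (m + 1) * y + 2 * y := by ring
    have e2 : 2 * (m : ℝ) * y = 2 * (m + 1) * y - 2 * y := by ring
    rw [e1, e2, Real.cos_add, Real.cos_sub, Real.cos_two_mul, Real.cos_sq' y]
    field_simp
    ring
  · refine sum_congr rfl fun s _ => ?_
    congr 2
    have e1 : 2 * ((p + 1 : ℕ) : ℝ) * (s * (2 * Real.pi / (2 * p + 1))) =
        s * (2 * Real.pi / (2 * p + 1)) + s * (2 * Real.pi) := by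
      push_cast; field_simp; ring
    have e2 : 2 * (p : ℝ) * (s * (2 * Real.pi / (2 * p + 1))) =
        s * (2 * Real.pi) - s * (2 * Real.pi / (2 * p + 1)) := by
      field_simp; ring
    rw [e1, e2, Real.cos_add_nat_mul_two_pi, Real.cos_nat_mul_two_pi_sub]
  · intro m hm
    rw [← sub_neg, ← sum_sub_distrib]
    have hterm : ∀ s ∈ Icc 1 p, -(Real.cos (s * (2 * Real.pi / (2 * p + 1))) /
        Real.sin (s * (2 * Real.pi / (2 * p + 1)))) *
          Real.cos (2 * (m + 1 : ℕ) * (s * (2 * Real.pi / (2 * p + 1)))) -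
        -(Real.cos (s * (2 * Real.pi / (2 * p + 1))) /
        Real.sin (s * (2 * Real.pi / (2 * p + 1)))) *
          Real.cos (2 * m * (s * (2 * Real.pi / (2 * p + 1)))) =
        Real.sin (2 * (m + 1 : ℕ) * (s * (2 * Real.pi / (2 * p + 1)))) +
          Real.sin (2 * m * (s * (2 * Real.pi / (2 * p + 1)))) := by
      intro s h
      have hs := hs s h
      generalize (s : ℝ) * (2 * Real.pi / (2 * p + 1)) = y at *
      push_cast
      have e1 : 2 * ((m : ℝ) + 1) * y = (2 * m + 1) * y + y := by ring
      have e2 : 2 * (m : ℝ) * y = (2 * m + 1) * y - y := by ring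
      rw [e1, e2, Real.cos_add, Real.cos_sub, Real.sin_add, Real.sin_sub]
      field_simp
      ring
    rw [sum_congr rfl hterm, sum_add_distrib]
    have hneg := sum_sin_neg (p := p) (m := m + 1) (by omega) (by omega)
    rcases Nat.eq_zero_or_pos m with rfl | hpos
    · simpa using hneg
    · linarith [sum_sin_neg (p := p) (m := m) hpos (by omega)]

/-- The kernel `-cos x / |sin x|³` has positive eigenvalues on the non-constant modes of a regular
polygon with an odd number of vertices. -/
theorem planar_kernel_pos {k : ZMod (2 * p + 1)} (hk : k ≠ 0) :
    0 < ∑ r : ZMod (2 * p + 1), -(Real.cos (zmodAngle r) / |Real.sin (zmodAngle r)| ^ 3) *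
      (1 - Real.cos (k.val * zmodAngle r)) := by
  have hper : Function.Periodic (fun x => -(Real.cos x / |Real.sin x| ^ 3) *
      (1 - Real.cos (k.val * x))) (2 * Real.pi) := by
    intro x
    simp only [Real.cos_add_two_pi, Real.sin_add_two_pi, mul_add, Real.cos_add_nat_mul_two_pi]
  rw [sum_zmodAngle_of_even (P := fun x => -(Real.cos x / |Real.sin x| ^ 3) *
      (1 - Real.cos (k.val * x))) hper (fun x => by simp)]
  have hn : (2 * (p : ℝ) + 1) ≠ 0 := by positivity
  have hk0 : k.val ≠ 0 := by rwa [ne_eq, ZMod.val_eq_zero]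
  have hklt : k.val < 2 * p + 1 := ZMod.val_lt k
  -- the modes `k` and `n - k` have the same eigenvalue, and one of the two indices is even
  obtain ⟨m, hm1, hm2, hmk⟩ : ∃ m : ℕ, 1 ≤ m ∧ m ≤ p ∧ ∀ s : ℕ,
      Real.cos (k.val * (s * (2 * Real.pi / (2 * p + 1)))) =
        Real.cos (2 * m * (s * (2 * Real.pi / (2 * p + 1)))) := by
    rcases Nat.even_or_odd' k.val with ⟨m, hm | hm⟩
    · refine ⟨m, by omega, by omega, fun s => ?_⟩
      rw [hm]
      push_cast
      rfl
    · refine ⟨p - m, by omega, by omega, fun s => ?_⟩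
      rw [hm, Nat.cast_sub (by omega), ← Real.cos_nat_mul_two_pi_sub _ s]
      congr 1
      push_cast
      field_simp
      ring
  have h := planar_eigenvalue_pos hm1 hm2
  simp only [mul_zero, Real.cos_zero, sub_self, zero_add]
  refine mul_pos two_pos (h.trans_eq (sum_congr rfl fun s hs => ?_))
  rw [hmk, abs_of_pos (Real.sin_pos_of_mem_Ioo
    (polygonAngle_mem_Ioo (mem_Icc.mp hs).1 (mem_Icc.mp hs).2))]

end Eigenvalues

/-! ### The second variation at the regular polygon -/

section Polygon

open Finset

theorem two_mul_sum_Ioi {n : ℕ} {G : Fin n → Fin n → ℝ} (hsymm : ∀ i j, G i j = G j i)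
    (hdiag : ∀ i, G i i = 0) : 2 * ∑ i, ∑ j ∈ Ioi i, G i j = ∑ i, ∑ j, G i j := by
  have h1 : ∑ i, ∑ j ∈ Iio i, G i j = ∑ i, ∑ j ∈ Ioi i, G i j := by
    rw [sum_comm' (s' := fun j => Ioi j) (t' := univ) (by simp)]
    exact sum_congr rfl fun i _ => sum_congr rfl fun j _ => hsymm j i
  have h2 : ∀ i, ∑ j, G i j = ∑ j ∈ Iio i, G i j + ∑ j ∈ Ioi i, G i j := by
    intro i
    rw [← sum_union]
    · refine (sum_subset (subset_univ _) fun j _ hj => ?_).symm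
      have : j = i := by
        simp only [mem_union, mem_Iio, mem_Ioi, not_or, not_lt] at hj
        exact le_antisymm hj.2 hj.1
      rw [this, hdiag]
    · exact disjoint_left.mpr fun j h1 h2 => by
        simp only [mem_Iio, mem_Ioi] at h1 h2
        exact lt_asymm h1 h2
  simp only [h2, sum_add_distrib, h1]
  ring

/-- The configuration of the regular polygon on the equator (the angular velocity only enters the
momenta, so `0` is taken for it). -/
abbrev polygonConfig (N : ℕ) : Config N := (polygonState N 0).1

variable {p : ℕ}

/-- The vertices of the regular polygon are indexed by residue classes. -/
theorem polygonConfig_sub (i j : Fin (2 * p + 1)) :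
    polygonConfig (2 * p) (Sum.inl i) - polygonConfig (2 * p) (Sum.inl j) =
      zmodAngle (ZMod.finEquiv (2 * p + 1) i) - zmodAngle (ZMod.finEquiv (2 * p + 1) j) := by
  have h : ∀ k : Fin (2 * p + 1), ((ZMod.finEquiv (2 * p + 1) k).val : ℝ) = ((k : ℕ) : ℝ) :=
    fun _ => rfl
  simp only [polygonConfig, polygonState, zmodAngle, Sum.elim_inl, h]
  push_cast
  ring

/-- A sum over the pairs of vertices of the polygon is half the sum over all pairs of residues. -/
theorem two_mul_polygon_sum {F : ℝ → ℝ → ℝ → ℝ} (hsymm : ∀ x u v, F (-x) v u = F x u v)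
    (hdiag : ∀ u, F 0 u u = 0) (a : ZMod (2 * p + 1) → ℝ) :
    2 * ∑ i, ∑ j ∈ Ioi i,
      F (polygonConfig (2 * p) (Sum.inl i) - polygonConfig (2 * p) (Sum.inl j))
        (a (ZMod.finEquiv (2 * p + 1) i)) (a (ZMod.finEquiv (2 * p + 1) j)) =
    ∑ i, ∑ j, F (zmodAngle i - zmodAngle j) (a i) (a j) := by
  rw [two_mul_sum_Ioi (fun i j => by rw [← hsymm, neg_sub]) (fun i => by rw [sub_self, hdiag])]
  simp only [polygonConfig_sub]
  refine Fintype.sum_equiv (ZMod.finEquiv (2 * p + 1)).toEquiv _ _ fun i => ?_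
  exact Fintype.sum_equiv (ZMod.finEquiv (2 * p + 1)).toEquiv _ _ fun j => rfl

/-- Sequences on the vertices are sequences on the residue classes. -/
theorem exists_eq_comp_finEquiv (a : Fin (2 * p + 1) → ℝ) :
    ∃ a' : ZMod (2 * p + 1) → ℝ, (∀ i, a' (ZMod.finEquiv (2 * p + 1) i) = a i) ∧
      ∀ f : ℝ → ℝ, ∑ i, f (a' i) = ∑ i, f (a i) := by
  refine ⟨fun r => a ((ZMod.finEquiv (2 * p + 1)).symm r), fun i => by simp, fun f => ?_⟩
  exact Fintype.sum_equiv (ZMod.finEquiv (2 * p + 1)).symm.toEquiv _ _ fun r => rfl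

/-- An odd polygon has no antipodal vertices. -/
theorem sin_zmodAngle_ne_zero {r : ZMod (2 * p + 1)} (hr : r ≠ 0) : Real.sin (zmodAngle r) ≠ 0 := by
  intro h
  obtain ⟨m, hm⟩ := Real.sin_eq_zero_iff.mp h
  have hpi := Real.pi_ne_zero
  have hr0 : r.val ≠ 0 := by rwa [ne_eq, ZMod.val_eq_zero]
  have hlt : r.val < 2 * p + 1 := ZMod.val_lt r
  have h1 : (m : ℝ) * (2 * p + 1) = 2 * r.val := by
    have hn : (2 * (p : ℝ) + 1) ≠ 0 := by positivity
    unfold zmodAngle at hm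
    push_cast at hm
    field_simp at hm
    linarith
  have h2 : m * (2 * (p : ℤ) + 1) = 2 * r.val := by exact_mod_cast h1
  have hm1 : 0 < m := by by_contra! hc; nlinarith [show (0 : ℤ) < r.val by omega]
  have hm2 : m < 2 := by by_contra! hc; nlinarith [show (r.val : ℤ) < 2 * p + 1 by omega]
  obtain rfl : m = 1 := by omega
  omega

theorem isEquatorial_polygonConfig (p : ℕ) : IsEquatorial (polygonConfig (2 * p)) := by
  refine ⟨fun i => rfl, fun i j hij => ?_⟩
  rw [polygonConfig_sub, Real.sin_periodic.apply_zmodAngle_sub]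
  exact sin_zmodAngle_ne_zero (sub_ne_zero.mpr ((ZMod.finEquiv (2 * p + 1)).injective.ne hij))

/-- Odd pair forces cancel at every vertex of the polygon. -/
theorem polygon_sum_odd_eq_zero {P : ℝ → ℝ} (hP : Function.Periodic P (2 * Real.pi))
    (hodd : ∀ x, P (-x) = -P x) (a : Fin (2 * p + 1) → ℝ) :
    ∑ i, ∑ j ∈ Ioi i, P (polygonConfig (2 * p) (Sum.inl i) - polygonConfig (2 * p) (Sum.inl j)) *
      (a i - a j) = 0 := by
  obtain ⟨a', ha, -⟩ := exists_eq_comp_finEquiv a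
  have h0 : ∀ i : ZMod (2 * p + 1), ∑ j : ZMod (2 * p + 1), P (zmodAngle i - zmodAngle j) = 0 := by
    intro i
    simpa [sum_zmodAngle_eq_zero_of_odd hP hodd] using
      sum_apply_zmodAngle_sub_mul hP (fun _ => 1) i
  have h0' : ∀ j : ZMod (2 * p + 1), ∑ i : ZMod (2 * p + 1), P (zmodAngle i - zmodAngle j) = 0 := by
    intro j
    rw [← neg_eq_zero, ← sum_neg_distrib, ← h0 j]
    exact sum_congr rfl fun i _ => by rw [← hodd, neg_sub]
  have h2 : ∑ i, ∑ j, P (zmodAngle i - zmodAngle j) * (a' i - a' j) = 0 := by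
    simp only [mul_sub, sum_sub_distrib, ← sum_mul, h0]
    rw [sum_comm (f := fun i j => P (zmodAngle i - zmodAngle j) * a' j)]
    simp only [← sum_mul, h0', zero_mul, sum_const_zero, sub_zero]
  have h3 := two_mul_polygon_sum (F := fun x u v => P x * (u - v))
    (fun x u v => by rw [hodd]; ring) (fun u => by ring) a'
  simp only [ha, h2] at h3
  linarith

theorem polygon_sum_even_mul {P : ℝ → ℝ} (hP : Function.Periodic P (2 * Real.pi))
    (heven : ∀ x, P (-x) = P x) (h0 : P 0 = 0) (b : Fin (2 * p + 1) → ℝ) :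
    ∑ i, ∑ j ∈ Ioi i, P (polygonConfig (2 * p) (Sum.inl i) - polygonConfig (2 * p) (Sum.inl j)) *
      (b i ^ 2 + b j ^ 2) =
    (2 * ∑ s ∈ Icc 1 p, P (s * (2 * Real.pi / (2 * p + 1)))) * ∑ i, b i ^ 2 := by
  obtain ⟨b', hb, hb2⟩ := exists_eq_comp_finEquiv b
  have hsum : ∀ i : ZMod (2 * p + 1), ∑ j : ZMod (2 * p + 1), P (zmodAngle i - zmodAngle j) =
      2 * ∑ s ∈ Icc 1 p, P (s * (2 * Real.pi / (2 * p + 1))) := by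
    intro i
    simpa [sum_zmodAngle_of_even hP heven, h0] using
      sum_apply_zmodAngle_sub_mul hP (fun _ => 1) i
  have hsum' : ∀ j : ZMod (2 * p + 1), ∑ i : ZMod (2 * p + 1), P (zmodAngle i - zmodAngle j) =
      2 * ∑ s ∈ Icc 1 p, P (s * (2 * Real.pi / (2 * p + 1))) := by
    intro j
    rw [← hsum j]
    exact sum_congr rfl fun i _ => by rw [← heven, neg_sub]
  have h3 := two_mul_polygon_sum (F := fun x u v => P x * (u ^ 2 + v ^ 2))
    (fun x u v => by rw [heven]; ring) (fun u => by rw [h0]; ring) b'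
  simp only [hb, mul_add, sum_add_distrib, ← sum_mul, hsum] at h3 ⊢
  rw [sum_comm (f := fun i j => P (zmodAngle i - zmodAngle j) * b' j ^ 2)] at h3
  simp only [← sum_mul, hsum', ← mul_sum, hb2 (fun x => x ^ 2)] at h3
  linarith

/-- The second variation of `-U` within the equator is positive modulo rotations. -/
theorem polygon_planar_pos {a : Fin (2 * p + 1) → ℝ} (ha : a ≠ 0) (hsum : ∑ i, a i = 0) :
    0 < ∑ i, ∑ j ∈ Ioi i,
      -(Real.cos (polygonConfig (2 * p) (Sum.inl i) - polygonConfig (2 * p) (Sum.inl j)) /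
        |Real.sin (polygonConfig (2 * p) (Sum.inl i) - polygonConfig (2 * p) (Sum.inl j))| ^ 3) *
          (a i - a j) ^ 2 := by
  obtain ⟨a', ha', hsum'⟩ := exists_eq_comp_finEquiv a
  have hP : Function.Periodic (fun x => -(Real.cos x / |Real.sin x| ^ 3)) (2 * Real.pi) := by
    intro x
    simp only [Real.cos_add_two_pi, Real.sin_add_two_pi]
  have hne : a' ≠ 0 := by
    rintro rfl
    exact ha (funext fun i => (ha' i).symm)
  have h1 := sum_mul_sub_sq_pos (fun k hk => planar_kernel_pos hk) hne
    ((hsum' fun x => x).trans hsum)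
  rw [← sum_congr rfl fun i _ => sum_apply_zmodAngle_sub_mul hP (fun j => (a' i - a' j) ^ 2) i,
    ← two_mul_polygon_sum (F := fun x u v => -(Real.cos x / |Real.sin x| ^ 3) * (u - v) ^ 2)
      (fun x u v => by rw [Real.cos_neg, Real.sin_neg, abs_neg]; ring) (fun u => by ring)] at h1
  simp only [ha'] at h1
  linarith

/-- The second variation of the Hamiltonian at the rotating regular polygon. Here `Θ` is the
largest eigenvalue of the meridional second variation of `U`, which belongs to the vector with
equal components. -/
def secondVariation (p : ℕ) (α Θ : ℝ) (w : Phase (2 * p)) : ℝ :=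
  ∑ i, w.2 (Sum.inl i) ^ 2 + ∑ i, w.2 (Sum.inr i) ^ 2 +
    (α ^ 2 - Θ) * ∑ i, w.1 (Sum.inr i) ^ 2 +
    ∑ i, ∑ j ∈ Ioi i, (w.1 (Sum.inr i) - w.1 (Sum.inr j)) ^ 2 /
      |Real.sin (polygonConfig (2 * p) (Sum.inl i) - polygonConfig (2 * p) (Sum.inl j))| ^ 3 +
    2 * ∑ i, ∑ j ∈ Ioi i,
      -(Real.cos (polygonConfig (2 * p) (Sum.inl i) - polygonConfig (2 * p) (Sum.inl j)) /
        |Real.sin (polygonConfig (2 * p) (Sum.inl i) - polygonConfig (2 * p) (Sum.inl j))| ^ 3) *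
          (w.1 (Sum.inl i) - w.1 (Sum.inl j)) ^ 2

variable {α Θ : ℝ}

theorem hasTwoJet_hamiltonian_polygonState (hΘ : Θ = 2 * ∑ j ∈ Icc 1 p,
      (1 - Real.cos (j * (2 * Real.pi / (2 * p + 1)))) /
        Real.sin (j * (2 * Real.pi / (2 * p + 1))) ^ 3) (w : Phase (2 * p)) :
    HasTwoJet (fun t : ℝ => hamiltonian (polygonState (2 * p) α + t • w))
      (hamiltonian (polygonState (2 * p) α)) (α * momentum w) (secondVariation p α Θ w) := by
  have hS : Function.Periodic (fun x => Real.sin x / |Real.sin x| ^ 3) (2 * Real.pi) := by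
    intro x
    simp only [Real.sin_add_two_pi]
  have hE : Function.Periodic (fun x => (1 - Real.cos x) / |Real.sin x| ^ 3) (2 * Real.pi) := by
    intro x
    simp only [Real.sin_add_two_pi, Real.cos_add_two_pi]
  refine ((isEquatorial_polygonConfig p).hasTwoJet_hamiltonian α w).congr (fun t => rfl) rfl ?_ ?_
  · rw [polygon_sum_odd_eq_zero hS (fun x => by simp [neg_div]) (fun i => w.1 (Sum.inl i)),
      add_zero]
  · have h := polygon_sum_even_mul hE (fun x => by simp) (by simp)
      (fun i => w.1 (Sum.inr i))
    have hΘ' : 2 * ∑ s ∈ Icc 1 p, (1 - Real.cos (s * (2 * Real.pi / (2 * p + 1)))) /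
        |Real.sin (s * (2 * Real.pi / (2 * p + 1)))| ^ 3 = Θ := by
      rw [hΘ]
      congr 1
      refine sum_congr rfl fun s hs => ?_
      rw [abs_of_pos (Real.sin_pos_of_mem_Ioo
        (polygonAngle_mem_Ioo (mem_Icc.mp hs).1 (mem_Icc.mp hs).2))]
    rw [hΘ'] at h
    rw [secondVariation, sub_mul, ← h]
    simp only [mul_sum, sub_eq_add_neg, ← sum_neg_distrib, add_assoc]
    congr 3
    simp only [← sum_add_distrib]
    exact sum_congr rfl fun i _ => sum_congr rfl fun j _ => by ring

/-- The condition `∑ aᵢ = 0` removes the rotations of the polygon, on which the form vanishes. -/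
theorem secondVariation_pos (hα : Θ < α ^ 2) {w : Phase (2 * p)} (hw : w ≠ 0)
    (hsum : ∑ i, w.1 (Sum.inl i) = 0) : 0 < secondVariation p α Θ w := by
  have hsq : ∀ f : Fin (2 * p + 1) → ℝ, 0 ≤ ∑ i, f i ^ 2 := fun f =>
    sum_nonneg fun i _ => sq_nonneg _
  have h1 := hsq fun i => w.2 (Sum.inl i)
  have h2 := hsq fun i => w.2 (Sum.inr i)
  have h3 := mul_nonneg (sub_pos.mpr hα).le (hsq fun i => w.1 (Sum.inr i))
  have h4 : 0 ≤ ∑ i, ∑ j ∈ Ioi i, (w.1 (Sum.inr i) - w.1 (Sum.inr j)) ^ 2 /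
      |Real.sin (polygonConfig (2 * p) (Sum.inl i) - polygonConfig (2 * p) (Sum.inl j))| ^ 3 :=
    sum_nonneg fun i _ => sum_nonneg fun j _ => by positivity
  unfold secondVariation
  by_cases ha : (fun i => w.1 (Sum.inl i)) = 0
  · have ha' : ∀ i, w.1 (Sum.inl i) = 0 := fun i => congrFun ha i
    simp only [ha', sub_self, ne_eq, OfNat.ofNat_ne_zero, not_false_eq_true, zero_pow, mul_zero,
      sum_const_zero, add_zero]
    refine lt_of_le_of_ne (by positivity) fun heq => hw ?_
    have hz : ∀ f : Fin (2 * p + 1) → ℝ, ∑ i, f i ^ 2 = 0 → ∀ i, f i = 0 := fun f hf i =>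
      pow_eq_zero_iff two_ne_zero |>.mp
        ((sum_eq_zero_iff_of_nonneg fun i _ => sq_nonneg (f i)).mp hf i (mem_univ i))
    have z1 := hz (fun i => w.2 (Sum.inl i)) (by linarith)
    have z2 := hz (fun i => w.2 (Sum.inr i)) (by linarith)
    have z3 := hz (fun i => w.1 (Sum.inr i))
      ((mul_eq_zero.mp (show (α ^ 2 - Θ) * _ = 0 by linarith)).resolve_left (sub_pos.mpr hα).ne')
    refine Prod.ext (funext fun i => ?_) (funext fun i => ?_) <;> rcases i with i | i
    · exact ha' i
    · exact z3 i
    · exact z1 i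
    · exact z2 i
  · linarith [polygon_planar_pos ha hsum]

/-- The direction in which all particles leave the equator together: `θᵢ` varies with velocity `1`
and `p_{θᵢ}` with velocity `μ`. The index type `ι` of the other coordinates is arbitrary, so that
this is a direction in the full as well as in the reduced phase space. -/
def meridional {ι : Type*} (p : ℕ) (μ : ℝ) :
    (ι ⊕ Fin (2 * p + 1) → ℝ) × (ι ⊕ Fin (2 * p + 1) → ℝ) :=
  (Sum.elim (fun _ => 0) (fun _ => 1), Sum.elim (fun _ => 0) (fun _ => μ))

/-- The polar form of the second variation against a meridional direction: only the sums of `θ`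
and `p_θ` enter, as the differences `bᵢ - bⱼ` and `aᵢ - aⱼ` of a meridional direction vanish. -/
theorem secondVariation_meridional_add (p : ℕ) (α Θ μ : ℝ) (w : Phase (2 * p)) :
    secondVariation p α Θ (meridional p μ + w) =
      secondVariation p α Θ (meridional p μ) + secondVariation p α Θ w +
        2 * (μ * ∑ i, w.2 (Sum.inr i) + (α ^ 2 - Θ) * ∑ i, w.1 (Sum.inr i)) := by
  simp only [secondVariation, meridional, Prod.fst_add, Prod.snd_add, Pi.add_apply, Sum.elim_inl,
    Sum.elim_inr, zero_add, add_sub_add_left_eq_sub, add_sq, sum_add_distrib, ← mul_sum, sub_self,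
    zero_pow two_ne_zero, zero_div, mul_zero, sum_const_zero]
  ring

end Polygon

/-! ### The reduced system -/

section Reduced

open Filter Topology

variable {N : ℕ}

theorem append_add (u u' : Fin N → ℝ) (g g' : ℝ) :
    append (fun k => u k + u' k) (g + g') = append u g + append u' g' := by
  funext i
  refine Fin.lastCases ?_ (fun k => ?_) i <;> simp [append]

theorem append_smul (t : ℝ) (u : Fin N → ℝ) :
    append (fun k => t * u k) 0 = t • append u 0 := by
  funext i
  refine Fin.lastCases ?_ (fun k => ?_) i <;> simp [append]

theorem lift_add (c g : ℝ) (z w : ReducedPhase N) : lift c g (z + w) = lift c g z + lift 0 0 w := by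
  have h : ∀ (u u' : Fin N → ℝ) (r : ℝ), append (fun k => u k + u' k) r =
      append u r + append u' 0 := fun u u' r => by rw [← append_add, add_zero]
  refine Prod.ext (funext fun i => ?_) (funext fun i => ?_) <;> rcases i with i | i <;>
    simp [lift, h, Matrix.mulVec_add]

/-- The differential of `lift c g`, as a linear map. -/
def liftLinear (N : ℕ) : ReducedPhase N →ₗ[ℝ] Phase N where
  toFun := lift 0 0
  map_add' := lift_add 0 0
  map_smul' t z := by
    refine Prod.ext (funext fun i => ?_) (funext fun i => ?_) <;> rcases i with i | i <;>
      simp [lift, append_smul, Matrix.mulVec_smul]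

theorem lift_injective : Function.Injective (liftLinear N) := by
  refine (injective_iff_map_eq_zero _).mpr fun w hw => ?_
  have hrot : ∀ x : Phase N, x = rotate 0 x := by
    intro x
    refine Prod.ext (funext fun i => ?_) rfl
    rcases i with i | i <;> simp [rotate]
  have h0 : (0 : Phase N) = rotate 0 (lift 0 0 0) := by
    rw [← hrot]; exact (map_zero (liftLinear N)).symm
  have h1 : (0 : Phase N) = rotate 0 (lift 0 0 w) := by rw [← hrot]; exact hw.symm
  have := (existsUnique_lift 0 (0 : Phase N) (by simp [momentum])).unique
    (y₁ := (w, 0)) (y₂ := (0, 0)) h1 h0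
  exact congrArg Prod.fst this

theorem sum_lift_eq_zero (w : ReducedPhase N) : ∑ i, (lift 0 0 w).1 (Sum.inl i) = 0 := by
  have h := jacobiMatrix_last (N := N) (fun i => (lift 0 0 w).1 (Sum.inl i))
  have hN : (N : ℝ) + 1 ≠ 0 := by positivity
  simp only [lift, Sum.elim_inl] at h ⊢
  rw [Matrix.mulVec_mulVec, Matrix.mul_nonsing_inv _ (isUnit_det_jacobiMatrix N),
    Matrix.one_mulVec] at h
  simp only [append, Fin.snoc_last] at h
  rcases div_eq_zero_iff.mp h.symm with h | h
  · exact h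
  · exact absurd h hN

theorem lift_vertical (b ζ : Fin (N + 1) → ℝ) :
    lift 0 0 ((Sum.elim (fun _ => 0) b, Sum.elim (fun _ => 0) ζ) : ReducedPhase N) =
      (Sum.elim (fun _ => 0) b, Sum.elim (fun _ => 0) ζ) := by
  have h : append (fun _ : Fin N => (0 : ℝ)) 0 = 0 := by
    funext i
    refine Fin.lastCases ?_ (fun k => ?_) i <;> simp [append]
  refine Prod.ext (funext fun i => ?_) (funext fun i => ?_) <;> rcases i with i | i <;>
    simp [lift, h]

theorem reducedHamiltonian_eq_lift (c g : ℝ) (z : ReducedPhase N) :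
    reducedHamiltonian N c z = hamiltonian (lift c g z) := by
  have h := rotate_lift g c 0 z
  rw [zero_add] at h
  rw [← h, hamiltonian_rotate, reducedHamiltonian]

theorem contDiff_lift (c g : ℝ) {n : WithTop ℕ∞} : ContDiff ℝ n (lift (N := N) c g) := by
  have h : lift (N := N) c g = fun z => lift c g 0 + (liftLinear N).toContinuousLinearMap z := by
    funext z
    conv_lhs => rw [← zero_add z, lift_add]
    rfl
  rw [h]
  exact contDiff_const.add (ContinuousLinearMap.contDiff _)

theorem isRegular_of_rotate {s : ℝ} {x : Phase N} (h : IsRegular (rotate s x).1) :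
    IsRegular x.1 := by
  have hinner : ∀ i j, inner ℝ (position (rotate s x).1 i) (position (rotate s x).1 j) =
      inner ℝ (position x.1 i) (position x.1 j) := by
    intro i j
    simp [inner_position, pairCos, rotate]
  have hnorm : ∀ (q : Config N) i, ‖position q i‖ = 1 := by
    intro q i
    rw [← sq_eq_sq₀ (norm_nonneg _) zero_le_one, ← real_inner_self_eq_norm_sq, inner_position,
      pairCos, sub_self, Real.cos_zero]
    linarith [Real.sin_sq_add_cos_sq (q (Sum.inr i))]
  refine ⟨h.1, fun i j hij => ⟨fun he => (h.2 i j hij).1 ?_, fun he => (h.2 i j hij).2 ?_⟩⟩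
  · rw [← inner_eq_one_iff_of_norm_eq_one (𝕜 := ℝ) (hnorm _ _) (hnorm _ _), hinner, he,
      inner_eq_one_iff_of_norm_eq_one (hnorm _ _) (hnorm _ _)]
  · rw [← inner_eq_neg_one_iff_of_norm_eq_one (𝕜 := ℝ) (hnorm _ _) (hnorm _ _), hinner, he,
      inner_neg_left, neg_inj, inner_eq_one_iff_of_norm_eq_one (hnorm _ _) (hnorm _ _)]

variable {p : ℕ} {α Θ : ℝ}

theorem reducedHamiltonian_polygon (p : ℕ) (α : ℝ) (z : ReducedPhase (2 * p)) :
    reducedHamiltonian (2 * p) ((2 * p + 1) * α) (polygonEquilibrium (2 * p) + z) =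
      hamiltonian (polygonState (2 * p) α + lift 0 0 z) := by
  rw [reducedHamiltonian_eq_lift _ (Real.pi * (((2 * p : ℕ) : ℝ) + 2) / (((2 * p : ℕ) : ℝ) + 1)),
    lift_add, ← lift_polygonEquilibrium]
  push_cast
  rfl

theorem contDiffAt_reducedHamiltonian (p : ℕ) (α : ℝ) {n : WithTop ℕ∞} :
    ContDiffAt ℝ n (reducedHamiltonian (2 * p) ((2 * p + 1) * α)) (polygonEquilibrium (2 * p)) := by
  have h : reducedHamiltonian (2 * p) ((2 * p + 1) * α) = fun z =>
      hamiltonian (lift (((2 * p : ℕ) + 1) * α)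
        (Real.pi * (((2 * p : ℕ) : ℝ) + 2) / (((2 * p : ℕ) : ℝ) + 1)) z) := by
    funext z
    rw [← reducedHamiltonian_eq_lift]
    push_cast
    rfl
  rw [h]
  refine ContDiffAt.comp (g := hamiltonian) _ ?_ (contDiff_lift _ _).contDiffAt
  rw [lift_polygonEquilibrium]
  exact (isEquatorial_polygonConfig p).contDiffAt_hamiltonian _

theorem reducedPhaseSpace_mem_nhds (p : ℕ) :
    reducedPhaseSpace (2 * p) ∈ 𝓝 (polygonEquilibrium (2 * p)) := by
  have hc : ContinuousAt (fun z : ReducedPhase (2 * p) => (lift (((2 * p : ℕ) + 1) * (0 : ℝ))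
        (Real.pi * (((2 * p : ℕ) : ℝ) + 2) / (((2 * p : ℕ) : ℝ) + 1)) z).1)
        (polygonEquilibrium (2 * p)) :=
    (continuous_fst.comp (contDiff_lift (n := 0) _ _).continuous).continuousAt
  have h := hc.eventually_mem (s := {q | IsRegular q}) (by
    rw [lift_polygonEquilibrium]
    exact (isEquatorial_polygonConfig p).isRegular_eventually)
  filter_upwards [h] with z hz
  have hr := rotate_lift (Real.pi * (((2 * p : ℕ) : ℝ) + 2) / (((2 * p : ℕ) : ℝ) + 1)) 0 0 z
  rw [zero_add] at hr
  refine isRegular_of_rotate (s := Real.pi * (((2 * p : ℕ) : ℝ) + 2) / (((2 * p : ℕ) : ℝ) + 1)) ?_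
  rw [hr]
  exact hz

/-- The polygon is a critical point of the reduced Hamiltonian, with the second variation of the
full one; the linear term `α ∑ ξᵢ` vanishes as the reduced directions have momentum `0`. -/
theorem polygon_derivatives (hΘ : Θ = 2 * ∑ j ∈ Finset.Icc 1 p,
      (1 - Real.cos (j * (2 * Real.pi / (2 * p + 1)))) /
        Real.sin (j * (2 * Real.pi / (2 * p + 1))) ^ 3) (w : ReducedPhase (2 * p)) :
    fderiv ℝ (reducedHamiltonian (2 * p) ((2 * p + 1) * α)) (polygonEquilibrium (2 * p)) w = 0 ∧
      fderiv ℝ (fderiv ℝ (reducedHamiltonian (2 * p) ((2 * p + 1) * α)))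
        (polygonEquilibrium (2 * p)) w w = secondVariation p α Θ (lift 0 0 w) := by
  have h := HasTwoJet.fderiv_eq (w := w) (contDiffAt_reducedHamiltonian p α)
    ((hasTwoJet_hamiltonian_polygonState (α := α) hΘ (lift 0 0 w)).congr (fun t => by
      rw [reducedHamiltonian_polygon]
      exact congrArg (fun y => hamiltonian (polygonState (2 * p) α + y))
        ((liftLinear (2 * p)).map_smul t w).symm) rfl rfl rfl)
  rwa [momentum_lift, mul_zero] at h

/-- The linearization at the polygon preserves the plane of the meridional motions, by
polarization of `secondVariation_meridional_add`. -/
theorem polygon_second_derivative_meridional (hΘ : Θ = 2 * ∑ j ∈ Finset.Icc 1 p,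
      (1 - Real.cos (j * (2 * Real.pi / (2 * p + 1)))) /
        Real.sin (j * (2 * Real.pi / (2 * p + 1))) ^ 3) (μ : ℝ) (w : ReducedPhase (2 * p)) :
    fderiv ℝ (fderiv ℝ (reducedHamiltonian (2 * p) ((2 * p + 1) * α)))
        (polygonEquilibrium (2 * p)) (meridional p μ) w =
      μ * ∑ i, w.2 (Sum.inr i) + (α ^ 2 - Θ) * ∑ i, w.1 (Sum.inr i) := by
  have hs : IsSymmSndFDerivAt ℝ (reducedHamiltonian (2 * p) ((2 * p + 1) * α))
      (polygonEquilibrium (2 * p)) :=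
    (contDiffAt_reducedHamiltonian p α (n := 2)).isSymmSndFDerivAt (by simp)
  have hq := fun w => (polygon_derivatives (α := α) hΘ w).2
  have h1 := hq (meridional p μ + w)
  have h2 : lift 0 0 (meridional p μ : ReducedPhase (2 * p)) = meridional p μ :=
    lift_vertical _ _
  have h3 : lift 0 0 (meridional p μ + w) = meridional p μ + lift 0 0 w := by
    rw [lift_add, h2]
  rw [h3, secondVariation_meridional_add, ← hq w] at h1
  have h4 := hq (meridional p μ)
  rw [h2] at h4
  rw [← h4] at h1
  simp only [map_add, add_apply] at h1
  rw [hs w (meridional p μ)] at h1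
  simp only [lift, Sum.elim_inr] at h1
  linarith

end Reduced

end CurvedNBody

end

theorem theorem7 (p : ℕ) (hp : 1 ≤ p) (α Θ₁ : ℝ)
    (hΘ₁ : Θ₁ = 2 * ∑ j ∈ Finset.Icc 1 p,
      (1 - Real.cos (j * (2 * Real.pi / (2 * p + 1)))) /
        Real.sin (j * (2 * Real.pi / (2 * p + 1))) ^ 3) :
    CurvedNBody.IsEquilibrium (CurvedNBody.reducedPhaseSpace (2 * p))
        (CurvedNBody.hamiltonianVectorField
          (CurvedNBody.reducedHamiltonian (2 * p) ((2 * p + 1) * α)))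
        (CurvedNBody.polygonEquilibrium (2 * p)) ∧
      (α ^ 2 < Θ₁ →
        CurvedNBody.IsLinearlyUnstable (CurvedNBody.reducedPhaseSpace (2 * p))
          (CurvedNBody.hamiltonianVectorField
            (CurvedNBody.reducedHamiltonian (2 * p) ((2 * p + 1) * α)))
          (CurvedNBody.polygonEquilibrium (2 * p))) ∧
      (Θ₁ < α ^ 2 →
        CurvedNBody.IsLyapunovStable (CurvedNBody.reducedPhaseSpace (2 * p))
          (CurvedNBody.hamiltonianVectorField
            (CurvedNBody.reducedHamiltonian (2 * p) ((2 * p + 1) * α)))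
          (CurvedNBody.polygonEquilibrium (2 * p))) := by
  have hfd : fderiv ℝ (CurvedNBody.reducedHamiltonian (2 * p) ((2 * p + 1) * α))
      (CurvedNBody.polygonEquilibrium (2 * p)) = 0 :=
    ContinuousLinearMap.ext fun w => (CurvedNBody.polygon_derivatives (α := α) hΘ₁ w).1
  have hsmooth := CurvedNBody.contDiffAt_reducedHamiltonian p α (n := 2)
  have hnhds := CurvedNBody.reducedPhaseSpace_mem_nhds p
  have heq : CurvedNBody.IsEquilibrium (CurvedNBody.reducedPhaseSpace (2 * p))
        (CurvedNBody.hamiltonianVectorField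
          (CurvedNBody.reducedHamiltonian (2 * p) ((2 * p + 1) * α)))
        (CurvedNBody.polygonEquilibrium (2 * p)) := by
    refine ⟨mem_of_mem_nhds hnhds, ?_⟩
    simp only [CurvedNBody.hamiltonianVectorField, hfd]
    ext <;> simp
  refine ⟨heq, fun hα => ⟨heq, ?_⟩, fun hα => ?_⟩
  · obtain ⟨L, hL, hLw⟩ := CurvedNBody.exists_hasFDerivAt_hamiltonianVectorField hsmooth
    have hpos : 0 < Θ₁ - α ^ 2 := sub_pos.mpr hα
    have hsq := Real.mul_self_sqrt hpos.le
    -- the linearization restricts to `η'' = (Θ₁ - α²) η` on the meridional plane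
    have hmer : L (CurvedNBody.meridional p (√(Θ₁ - α ^ 2))) =
        √(Θ₁ - α ^ 2) • CurvedNBody.meridional p (√(Θ₁ - α ^ 2)) := by
      rw [hLw]
      simp only [CurvedNBody.polygon_second_derivative_meridional hΘ₁]
      refine Prod.ext (funext fun i => ?_) (funext fun i => ?_) <;> rcases i with i | i
      · simp [CurvedNBody.meridional]
      · simp [CurvedNBody.meridional, Pi.single_apply]
      · simp [CurvedNBody.meridional]
      · simp [CurvedNBody.meridional, Pi.single_apply, hsq]
    have hne : (CurvedNBody.meridional p (√(Θ₁ - α ^ 2)) :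
        CurvedNBody.ReducedPhase (2 * p)) ≠ 0 := by
      intro h
      have := congrFun (congrArg Prod.fst h) (Sum.inr 0)
      simp [CurvedNBody.meridional] at this
    exact ⟨L, hL, (√(Θ₁ - α ^ 2) : ℝ), by simpa using hpos,
      CurvedNBody.hasEigenvalue_baseChange_complex hne hmer⟩
  · refine CurvedNBody.isLyapunovStable_of_posDef hnhds hsmooth hfd fun w hw => ?_
    rw [(CurvedNBody.polygon_derivatives hΘ₁ w).2]
    refine CurvedNBody.secondVariation_pos hα ?_ (CurvedNBody.sum_lift_eq_zero w)
    exact fun h => hw (CurvedNBody.lift_injective (h.trans (map_zero _).symm))
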